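/- Let $\tau\neq 0$ and $\delta\in\{1,-1\}$, and let $H_3(\tau)$ be $\mathbb{R}^3$ with the Lorentzian metric $$g_\tau=dx^2-\delta\,dy^2+\delta\bigl(dz+\tau(y\,dx-x\,dy)\bigr)^2,\qquad E_3=\partial_z .$$ Let $F:M\to H_3(\tau)$ be a smooth immersion of a connected smooth surface with a smooth normal field $N$ satisfying $g_\tau(N,N)=\varepsilon\in\{1,-1\}$; let $S X=-\nabla^{\tau}_X N$ be its shape operator and $H=\tfrac12\operatorname{tr}S$ its mean curvature. The surface is timelike (spacelike) if its induced metric is Lorentzian (Riemannian). It is minimal if $H=0$, proper CMC if $H$ is a nonzero constant, flat if the Gaussian curvature of the induced metric is zero, and a constant angle (helix) surface with angle $\nu$ if $\varepsilon\, g_\tau(N,E_3)=\nu$ is constant. We say that $M$ is parametrized by $P(u,v)$ up to isometry if there is an isometry $\Phi$ of $H_3(\tau)$ such that around every point of $M$ there are smooth local coordinates $(u,v)$ with $F=\Phi\circ P(u,v)$. (1) If $M$ is a minimal constant angle surface, then $M$ is flat and, for some real constant $\varphi_0$, up to isometry: - if $\delta=-1$, $M$ is timelike and parametrized by $(\sin\varphi_0\,v,\,-\cos\varphi_0\,v,\,u)$;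 - if $\delta=1$, either $M$ is timelike and parametrized by $(\sinh\varphi_0\,v,\,\cosh\varphi_0\,v,\,u)$, or $M$ is spacelike and parametrized by $(\cosh\varphi_0\,v,\,\sinh\varphi_0\,v,\,u)$. Conversely, for every $\varphi_0$ every open part of each of these "planes" is a flat minimal constant angle surface (with $\nu=0$) of the stated causal type. (2) For every $r>0$, every open part of each of the following "cylinders" is a flat proper CMC constant angle surface with $\nu=0$ and $|H|=\frac1{2r}$, of the stated causal type: - if $\delta=-1$: $(-r\cos v,\,-r\sin v,\,u-\tau r^2 v)$, timelike; - if $\delta=1$: $(r\cosh v,\,r\sinh v,\,u-\tau r^2 v)$, timelike, and $(r\sinh v,\,r\cosh v,\,u+\tau r^2 v)$, spacelike. In particular, for $r=1$, $H_3(\tau)$ admits as proper CMC surfaces all open parts of $(-\cos v,-\sin v,u-\tau v)$ if $\delta=-1$, and of $(\cosh v,\sinh v,u-\tau v)$ (timelike) and $(\sinh v,\cosh v,u+\tau v)$ (spacelike) if $\delta=1$. (3) If $M$ is a constant angle surface with angle $\nu$ and constant mean curvature $H\neq0$, then either $\nu=0$, $M$ is flat, and $M$ is, up to isometry, parametrized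 by one of the cylinders in (2) with $r=\frac{1}{2|H|}$, according to $\delta$ and its causal type (it is timelike if $\delta=-1$); or $\delta=1$ and $H^2=\tau^2\nu^2$. -/

import Mathlib

open scoped Manifold ContDiff Matrix

noncomputable section

namespace LorentzHeisenberg

/-! ### Pseudo-Riemannian metrics in coordinates -/

section Coordinates

variable {ι : Type} [Fintype ι] [DecidableEq ι]

/-- The partial derivative of `f` at `x` in the `i`-th coordinate direction. -/
def partialD (i : ι) (f : (ι → ℝ) → ℝ) (x : ι → ℝ) : ℝ :=
  fderiv ℝ f x (Pi.single i 1)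

/-- The Christoffel symbol `Γ^k_{ij}` of the Levi-Civita connection of the metric with
coefficient matrix `g`. -/
def christoffel (g : (ι → ℝ) → Matrix ι ι ℝ) (k i j : ι) (x : ι → ℝ) : ℝ :=
  (1 / 2) * ∑ l, (g x)⁻¹ k l *
    (partialD i (fun y => g y j l) x + partialD j (fun y => g y i l) x
      - partialD l (fun y => g y i j) x)

/-- The component along `∂_l` of `R(∂_i, ∂_j) ∂_k`, where
`R(X, Y) = [∇_X, ∇_Y] - ∇_{[X, Y]}` is the curvature tensor of the metric `g`. -/
def riemann (g : (ι → ℝ) → Matrix ι ι ℝ) (l k i j : ι) (x : ι → ℝ) : ℝ :=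
  partialD i (christoffel g l j k) x - partialD j (christoffel g l i k) x
    + ∑ m, (christoffel g l i m x * christoffel g m j k x
        - christoffel g l j m x * christoffel g m i k x)

end Coordinates

/-- The Gaussian curvature `g(R(∂_0, ∂_1) ∂_1, ∂_0) / det g` of a metric on (an open part of)
the plane. -/
def planeCurvature (g : (Fin 2 → ℝ) → Matrix (Fin 2) (Fin 2) ℝ) (x : Fin 2 → ℝ) : ℝ :=
  (∑ l, g x 0 l * riemann g l 1 0 1 x) / (g x).det

/-! ### The Lorentzian Heisenberg group -/

/-- The coefficients of the one-form `dz + τ (y dx - x dy)` at `p = (x, y, z)`. -/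
def contactForm (τ : ℝ) (p : Fin 3 → ℝ) : Fin 3 → ℝ :=
  ![τ * p 1, -(τ * p 0), 1]

/-- The coefficient matrix of `dx² - δ dy² + δ (dz + τ (y dx - x dy))²`. -/
def metric (τ δ : ℝ) (p : Fin 3 → ℝ) : Matrix (Fin 3) (Fin 3) ℝ :=
  Matrix.diagonal ![1, -δ, 0] + δ • Matrix.vecMulVec (contactForm τ p) (contactForm τ p)

/-- The scalar product of two tangent vectors at `p`. -/
def ip (τ δ : ℝ) (p v w : Fin 3 → ℝ) : ℝ :=
  v ⬝ᵥ (metric τ δ p *ᵥ w)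

/-- The vertical vector field `E₃ = ∂/∂z`. -/
def E3 : Fin 3 → ℝ := ![0, 0, 1]

/-- Isometries of the ambient space: diffeomorphisms of `ℝ³` that preserve the metric. -/
structure IsAmbientIsometry (τ δ : ℝ) (Φ : (Fin 3 → ℝ) ≃ (Fin 3 → ℝ)) : Prop where
  smooth : ContDiff ℝ ∞ Φ
  smooth_symm : ContDiff ℝ ∞ Φ.symm
  preserves : ∀ p v w : Fin 3 → ℝ,
    ip τ δ (Φ p) (fderiv ℝ Φ p v) (fderiv ℝ Φ p w) = ip τ δ p v w

/-! ### Immersed surfaces -/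

section Surfaces

variable {M : Type*} [TopologicalSpace M] [ChartedSpace (Fin 2 → ℝ) M]

/-- The differential of an `ℝ³`-valued map on a surface. -/
def diff (F : M → Fin 3 → ℝ) (p : M) :
    TangentSpace 𝓘(ℝ, Fin 2 → ℝ) p →L[ℝ] (Fin 3 → ℝ) :=
  mfderiv 𝓘(ℝ, Fin 2 → ℝ) 𝓘(ℝ, Fin 3 → ℝ) F p

/-- `F` is a smooth immersion of the surface `M` and `N` is a smooth `ε`-unit normal vector field
along it, `ε = ±1`; in particular the induced metric is non-degenerate. -/
structure IsOrientedSurface (τ δ ε : ℝ) (F N : M → Fin 3 → ℝ) : Prop where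
  smooth : ContMDiff 𝓘(ℝ, Fin 2 → ℝ) 𝓘(ℝ, Fin 3 → ℝ) ∞ F
  immersion : ∀ p, Function.Injective (diff F p)
  normal_smooth : ContMDiff 𝓘(ℝ, Fin 2 → ℝ) 𝓘(ℝ, Fin 3 → ℝ) ∞ N
  sign : ε = 1 ∨ ε = -1
  normal_unit : ∀ p, ip τ δ (F p) (N p) (N p) = ε
  normal_orthogonal : ∀ p X, ip τ δ (F p) (N p) (diff F p X) = 0

/-- A constant angle surface with angle `ν`: the angle function `ε g(N, E₃)` is equal to `ν`. -/
structure IsHelixSurface (τ δ ε ν : ℝ) (F N : M → Fin 3 → ℝ) : Prop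
    extends IsOrientedSurface τ δ ε F N where
  angle : ∀ p, ε * ip τ δ (F p) (N p) E3 = ν

/-- The ambient Levi-Civita derivative of the vector field `V` along `F` in the direction of the
tangent vector `X` of the surface. -/
def covDeriv (τ δ : ℝ) (F V : M → Fin 3 → ℝ) (p : M)
    (X : TangentSpace 𝓘(ℝ, Fin 2 → ℝ) p) : Fin 3 → ℝ :=
  fun k => diff V p X k
    + ∑ i, ∑ j, christoffel (metric τ δ) k i j (F p) * diff F p X i * V p j

/-- `S` is the shape operator at `p`: `S X = -∇_X N` (unique, since `diff F p` is injective). -/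
def IsShapeOperator (τ δ : ℝ) (F N : M → Fin 3 → ℝ) (p : M)
    (S : TangentSpace 𝓘(ℝ, Fin 2 → ℝ) p →ₗ[ℝ] TangentSpace 𝓘(ℝ, Fin 2 → ℝ) p) : Prop :=
  ∀ X, diff F p (S X) = -covDeriv τ δ F N p X

/-- The surface has constant mean curvature `H`, that is, `tr S / 2 = H` at every point. -/
def HasConstantMeanCurvature (τ δ : ℝ) (F N : M → Fin 3 → ℝ) (H : ℝ) : Prop :=
  ∀ p, ∃ S, IsShapeOperator τ δ F N p S ∧
    (1 / 2) * LinearMap.trace ℝ (TangentSpace 𝓘(ℝ, Fin 2 → ℝ) p) S = H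

/-- Minimal surfaces: the mean curvature vanishes. -/
def IsMinimal (τ δ : ℝ) (F N : M → Fin 3 → ℝ) : Prop :=
  HasConstantMeanCurvature τ δ F N 0

/-- The induced metric of `F` is Riemannian. -/
def IsSpacelike (τ δ : ℝ) (F : M → Fin 3 → ℝ) : Prop :=
  ∀ p X, X ≠ 0 → 0 < ip τ δ (F p) (diff F p X) (diff F p X)

/-- The induced metric of `F` is Lorentzian. -/
def IsTimelike (τ δ : ℝ) (F : M → Fin 3 → ℝ) : Prop :=
  ∀ p, (∃ X, ip τ δ (F p) (diff F p X) (diff F p X) < 0) ∧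
    ∃ X, 0 < ip τ δ (F p) (diff F p X) (diff F p X)

/-- The coefficients of the metric induced on the parameter domain by a map into `ℝ³`. -/
def firstForm (τ δ : ℝ) (f : (Fin 2 → ℝ) → Fin 3 → ℝ) (x : Fin 2 → ℝ) :
    Matrix (Fin 2) (Fin 2) ℝ :=
  Matrix.of fun i j =>
    ip τ δ (f x) (fderiv ℝ f x (Pi.single i 1)) (fderiv ℝ f x (Pi.single j 1))

/-- The Gaussian curvature of the induced metric, computed in the chart at the point. -/
def gaussCurvature (τ δ : ℝ) (F : M → Fin 3 → ℝ) (p : M) : ℝ :=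
  planeCurvature (firstForm τ δ (F ∘ (chartAt (Fin 2 → ℝ) p).symm)) (chartAt (Fin 2 → ℝ) p p)

/-- Flat surfaces: the Gaussian curvature of the induced metric vanishes. -/
def IsFlat (τ δ : ℝ) (F : M → Fin 3 → ℝ) : Prop :=
  ∀ p, gaussCurvature τ δ F p = 0

/-- Up to one ambient isometry `Φ`, the surface is parametrized by `P`: around every point there
are smooth local coordinates `e = (u, v)` in which `F` is `Φ (P (u, v))`. -/
def IsParametrizedBy (τ δ : ℝ) (F : M → Fin 3 → ℝ) (P : (Fin 2 → ℝ) → Fin 3 → ℝ) : Prop :=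
  ∃ Φ : (Fin 3 → ℝ) ≃ (Fin 3 → ℝ), IsAmbientIsometry τ δ Φ ∧
    ∀ p, ∃ e ∈ IsManifold.maximalAtlas 𝓘(ℝ, Fin 2 → ℝ) ∞ M,
      p ∈ e.source ∧ ∀ q ∈ e.source, F q = Φ (P (e q))

end Surfaces

/-! ### The model surfaces, with parameters `w = (u, v)` -/

/-- `(sin φ₀ v, -cos φ₀ v, u)`. -/
def planeA (φ₀ : ℝ) (w : Fin 2 → ℝ) : Fin 3 → ℝ :=
  ![Real.sin φ₀ * w 1, -Real.cos φ₀ * w 1, w 0]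

/-- `(sinh φ₀ v, cosh φ₀ v, u)`. -/
def planeB (φ₀ : ℝ) (w : Fin 2 → ℝ) : Fin 3 → ℝ :=
  ![Real.sinh φ₀ * w 1, Real.cosh φ₀ * w 1, w 0]

/-- `(cosh φ₀ v, sinh φ₀ v, u)`. -/
def planeC (φ₀ : ℝ) (w : Fin 2 → ℝ) : Fin 3 → ℝ :=
  ![Real.cosh φ₀ * w 1, Real.sinh φ₀ * w 1, w 0]

/-- `(-r cos v, -r sin v, u - τ r² v)`. -/
def cylinderA (τ r : ℝ) (w : Fin 2 → ℝ) : Fin 3 → ℝ :=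
  ![-(r * Real.cos (w 1)), -(r * Real.sin (w 1)), w 0 - τ * r ^ 2 * w 1]

/-- `(r cosh v, r sinh v, u - τ r² v)`. -/
def cylinderB (τ r : ℝ) (w : Fin 2 → ℝ) : Fin 3 → ℝ :=
  ![r * Real.cosh (w 1), r * Real.sinh (w 1), w 0 - τ * r ^ 2 * w 1]

/-- `(r sinh v, r cosh v, u + τ r² v)`. -/
def cylinderC (τ r : ℝ) (w : Fin 2 → ℝ) : Fin 3 → ℝ :=
  ![r * Real.sinh (w 1), r * Real.cosh (w 1), w 0 + τ * r ^ 2 * w 1]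

/-- The restriction of a parametrized surface to an open part of the parameter plane. -/
def restrict (Ω : TopologicalSpace.Opens (Fin 2 → ℝ)) (P : (Fin 2 → ℝ) → Fin 3 → ℝ) :
    Ω → Fin 3 → ℝ :=
  fun w => P w

/-- Every open part of the surface parametrized by `P`, with a suitable `ε`-unit normal, is a flat
constant angle surface with angle `0` and constant mean curvature of absolute value `h`. -/
def IsFlatCMCHelixModel (τ δ ε h : ℝ) (P : (Fin 2 → ℝ) → Fin 3 → ℝ) : Prop :=
  ∀ Ω : TopologicalSpace.Opens (Fin 2 → ℝ), ∃ (N : Ω → Fin 3 → ℝ) (H : ℝ),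
    |H| = h ∧ IsHelixSurface τ δ ε 0 (restrict Ω P) N ∧
    HasConstantMeanCurvature τ δ (restrict Ω P) N H ∧ IsFlat τ δ (restrict Ω P)

end LorentzHeisenberg

end

/-! Use the orthonormal frame E₁ = ∂x − τy ∂z, E₂ = ∂y + τx ∂z, E₃ = ∂z and the contact form θ. A
constant angle normal is aE₁ + bE₂ + cE₃ with c constant and c² = ν², so (a, b) moves on the conic
a² − δb² = D, where D = ε − δc². If D ≠ 0, its motion is recorded by the single 1-form P = a db − b
da. Two linear equations determine P: the exterior derivative of the relation a dx − δb dy + δcθ = 0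
on the surface, and tr S = 2H. The result is P = 2τδc² θ + 2H(b dx − a dy), which is
`FrameEquations.rotation`.

Case ν ≠ 0. If D ≠ 0, then P is closed because (a, b) stays on a conic, and dP = 0 reduces to H² =
δτ²c² (`LocalHelix.sq_eq_of_ne`). If D = 0, then (a, b) is null. It cannot vanish on an open set,
since the surface would be tangent to the non-integrable distribution ker θ. This excludes δ = −1,
and for δ = 1 the same two equations give H = ±τc. So ν ≠ 0 leaves only δ = 1 and H² = τ²ν², which
is impossible for minimal surfaces.

Case ν = 0. Now P = 2H(b dx − a dy), and tangency turns this into da = −2H dx, db = −2H dy: the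
horizontal part of N + 2HF is constant (`IsHelixSurface.exists_center`). For H = 0 the horizontal
normal is constant and the surface projects into a line; for H ≠ 0 it projects into a conic of
radius 1/(2|H|). The curve parameter and the height then give a map to the plane that is immersive
because F is, hence a local chart by the inverse function theorem (`isParametrizedBy_of_local`).

All models are vertical cylinders over curves described by `CurveData`. Their first fundamental form
is constant, so every surface parametrized by one carries the pullback of a constant metric and is
flat (`riemann_eq_zero`). The causal type is read off from the same constant form. -/

noncomputable section

namespace LorentzHeisenberg

open Filter Topology

/-! ### The ambient metric and its connection -/

/-- The value of the one-form `dz + τ (y dx - x dy)` on a tangent vector. -/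
def theta (τ : ℝ) (p v : Fin 3 → ℝ) : ℝ := v 2 + τ * (p 1 * v 0 - p 0 * v 1)

theorem ip_eq (τ δ : ℝ) (p v w : Fin 3 → ℝ) :
    ip τ δ p v w = v 0 * w 0 - δ * (v 1 * w 1) + δ * (theta τ p v * theta τ p w) := by
  simp only [ip, metric, contactForm, dotProduct, Matrix.mulVec, Fin.sum_univ_three, theta,
    Matrix.add_apply, Matrix.smul_apply, Matrix.vecMulVec_apply, Matrix.diagonal_apply]
  simp
  ring

/-- The three vectors are the orthonormal frame E₁, E₂, E₃ with squares 1, −δ, δ; the inverse metric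
is the sum of their tensor squares weighted by the inverse squares, and δ is its own inverse. -/
theorem metric_inv (τ : ℝ) {δ : ℝ} (hδ : δ ^ 2 = 1) (p : Fin 3 → ℝ) : (metric τ δ p)⁻¹ =
    Matrix.vecMulVec ![1, 0, -(τ * p 1)] ![1, 0, -(τ * p 1)]
      - δ • Matrix.vecMulVec ![0, 1, τ * p 0] ![0, 1, τ * p 0]
      + δ • Matrix.vecMulVec ![0, 0, 1] ![0, 0, 1] := by
  apply Matrix.inv_eq_right_inv
  ext i j
  simp only [metric, contactForm, Matrix.mul_apply, Fin.sum_univ_three,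
    Matrix.add_apply, Matrix.sub_apply, Matrix.smul_apply, Matrix.vecMulVec_apply,
    Matrix.diagonal_apply, Matrix.one_apply]
  revert i j
  simp only [Fin.forall_fin_succ, Fin.isValue, Matrix.cons_val]
  simp
  grind

theorem hasFDerivAt_coord {n : ℕ} (i : Fin n) (x : Fin n → ℝ) :
    HasFDerivAt (fun y : Fin n → ℝ => y i) (ContinuousLinearMap.proj (R := ℝ) i) x :=
  (ContinuousLinearMap.proj (R := ℝ) (φ := fun _ : Fin n => ℝ) i).hasFDerivAt

/-- The derivative of the coefficients of the contact form. -/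
def contactFormDeriv (τ : ℝ) (v : Fin 3 → ℝ) : Fin 3 → ℝ := ![τ * v 1, -(τ * v 0), 0]

theorem hasFDerivAt_contactForm (τ : ℝ) (i : Fin 3) (p : Fin 3 → ℝ) :
    ∃ A : (Fin 3 → ℝ) →L[ℝ] ℝ, HasFDerivAt (fun y => contactForm τ y i) A p ∧
      ∀ v, A v = contactFormDeriv τ v i := by
  revert i
  simp only [Fin.forall_fin_succ]
  refine ⟨⟨_, (hasFDerivAt_coord 1 p).const_mul τ, fun v => ?_⟩,
    ⟨_, ((hasFDerivAt_coord 0 p).const_mul τ).neg, fun v => ?_⟩,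
    ⟨_, hasFDerivAt_const 1 p, fun v => ?_⟩, fun i => i.elim0⟩
  all_goals simp [contactFormDeriv]

theorem partialD_metric (τ δ : ℝ) (l i j : Fin 3) (p : Fin 3 → ℝ) :
    partialD l (fun y => metric τ δ y i j) p =
      δ * (contactForm τ p i * contactFormDeriv τ (Pi.single l 1) j
        + contactFormDeriv τ (Pi.single l 1) i * contactForm τ p j) := by
  obtain ⟨A, hA, hA'⟩ := hasFDerivAt_contactForm τ i p
  obtain ⟨B, hB, hB'⟩ := hasFDerivAt_contactForm τ j p
  have := ((((hA.mul hB).const_mul δ)).const_add (Matrix.diagonal ![1, -δ, 0] i j)).fderiv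
  have h2 : (fun y => metric τ δ y i j) = fun y => Matrix.diagonal ![1, -δ, 0] i j
      + δ * (contactForm τ y i * contactForm τ y j) := by
    ext y
    simp [metric, Matrix.vecMulVec_apply]
  rw [partialD, h2]
  erw [this]
  simp [hA', hB']
  ring

/-- The Christoffel symbols of the ambient metric, contracted with two tangent vectors. -/
theorem christoffel_contract (τ : ℝ) {δ : ℝ} (hδ : δ ^ 2 = 1) (p v w : Fin 3 → ℝ) :
    (fun k => ∑ i, ∑ j, christoffel (metric τ δ) k i j p * v i * w j) =
      ![δ * τ * (w 1 * theta τ p v + theta τ p w * v 1),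
        τ * (w 0 * theta τ p v + theta τ p w * v 0),
        τ * p 0 * (τ * (w 0 * theta τ p v + theta τ p w * v 0))
          - τ * p 1 * (δ * τ * (w 1 * theta τ p v + theta τ p w * v 1))] := by
  ext k
  simp only [christoffel, partialD_metric, metric_inv τ hδ, Fin.sum_univ_three, theta,
    contactForm, contactFormDeriv, 
    Matrix.add_apply, Matrix.sub_apply, Matrix.smul_apply, Matrix.vecMulVec_apply]
  revert k
  simp only [Fin.forall_fin_succ, Fin.isValue, Matrix.cons_val]
  simp
  refine ⟨?_, ?_, ?_⟩ <;> grind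

/-! ### Calculus of partial derivatives -/

section PartialDerivatives

variable {ι : Type} [DecidableEq ι] {f g : (ι → ℝ) → ℝ} {x : ι → ℝ} (i j : ι)

theorem partialD_congr (h : f =ᶠ[𝓝 x] g) : partialD i f x = partialD i g x := by
  rw [partialD, partialD, h.fderiv_eq]

theorem partialD_const (r : ℝ) : partialD i (fun _ => r) x = 0 := by
  simp [partialD]

variable [Fintype ι]

theorem partialD_add (hf : DifferentiableAt ℝ f x) (hg : DifferentiableAt ℝ g x) :
    partialD i (fun y => f y + g y) x = partialD i f x + partialD i g x := by
  simp only [partialD, fderiv_fun_add hf hg, add_apply]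

theorem partialD_sub (hf : DifferentiableAt ℝ f x) (hg : DifferentiableAt ℝ g x) :
    partialD i (fun y => f y - g y) x = partialD i f x - partialD i g x := by
  simp only [partialD, fderiv_fun_sub hf hg, sub_apply]

theorem partialD_mul (hf : DifferentiableAt ℝ f x) (hg : DifferentiableAt ℝ g x) :
    partialD i (fun y => f y * g y) x = partialD i f x * g x + f x * partialD i g x := by
  simp only [partialD, fderiv_fun_mul hf hg, add_apply,
    smul_apply, smul_eq_mul]
  ring

theorem partialD_sum {κ : Type*} (s : Finset κ) {f : κ → (ι → ℝ) → ℝ}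
    (hf : ∀ a ∈ s, DifferentiableAt ℝ (f a) x) :
    partialD i (fun y => ∑ a ∈ s, f a y) x = ∑ a ∈ s, partialD i (f a) x := by
  simp only [partialD, fderiv_fun_sum hf, sum_apply]

theorem contDiffAt_partialD (hf : ContDiffAt ℝ ∞ f x) : ContDiffAt ℝ ∞ (partialD i f) x :=
  (hf.fderiv_right (m := ∞) (by simp)).clm_apply contDiffAt_const

theorem partialD_comm (hf : ContDiffAt ℝ ∞ f x) :
    partialD i (partialD j f) x = partialD j (partialD i f) x := by
  have h1 : DifferentiableAt ℝ (fderiv ℝ f) x :=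
    (hf.fderiv_right (m := ∞) (by simp)).differentiableAt (by simp)
  have key : ∀ i j : ι, partialD i (partialD j f) x
      = fderiv ℝ (fderiv ℝ f) x (Pi.single i 1) (Pi.single j 1) := by
    intro i j
    have := (h1.hasFDerivAt.clm_apply (hasFDerivAt_const (Pi.single j (1 : ℝ)) x)).fderiv
    change fderiv ℝ (fun y => fderiv ℝ f y (Pi.single j 1)) x _ = _
    rw [this]
    simp
  rw [key, key]
  exact (hf.isSymmSndFDerivAt (by
    simpa using (mod_cast (le_top : (2 : ℕ∞) ≤ ⊤) : ((2 : ℕ∞) : WithTop ℕ∞) ≤ ∞))) _ _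

theorem fderiv_apply_eq_sum (v : ι → ℝ) :
    fderiv ℝ f x v = ∑ i, v i * partialD i f x := by
  conv_lhs => rw [← Finset.univ_sum_single v]
  rw [map_sum]
  refine Finset.sum_congr rfl fun i _ => ?_
  rw [partialD, ← smul_eq_mul, ← map_smul, ← Pi.single_smul, smul_eq_mul, mul_one]

end PartialDerivatives

/-! ### The equations of a constant angle surface at a point

The frame components of the coordinate vectors of the surface are `(xᵢ, yᵢ, wᵢ)`, those of the
normal are `(a, b, c)`, and `aᵢ`, `bᵢ` are the derivatives of `a`, `b`; the third component `c` is
constant. -/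

/-- The structure equations of a surface of mean curvature `H` with `c` constant. -/
structure FrameEquations (τ δ ε c H k a b x₀ x₁ y₀ y₁ w₀ w₁ a₀ a₁ b₀ b₁ : ℝ) : Prop where
  delta : δ ^ 2 = 1
  eps : ε ^ 2 = 1
  unit : a ^ 2 - δ * b ^ 2 + δ * c ^ 2 = ε
  area : k ≠ 0
  -- Both coordinate vectors are annihilated by the covector (a, −δb, δc) dual to the normal, so
  -- their cross product is a multiple `k` of it.
  cross_fst : y₀ * w₁ - y₁ * w₀ = k * a
  cross_snd : w₀ * x₁ - w₁ * x₀ = -(k * (δ * b))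
  cross_thd : x₀ * y₁ - x₁ * y₀ = k * (δ * c)
  normal_fst : a * x₀ - δ * b * y₀ + δ * c * w₀ = 0
  normal_snd : a * x₁ - δ * b * y₁ + δ * c * w₁ = 0
  unit_fst : a * a₀ = δ * (b * b₀)
  unit_snd : a * a₁ = δ * (b * b₁)
  -- The form a dx − δb dy + δcθ vanishes on the surface; this is its exterior derivative, with dθ =
  -- −2τ dx∧dy.
  closed : (a₀ * x₁ - a₁ * x₀) - δ * (b₀ * y₁ - b₁ * y₀)
    = 2 * τ * (δ * c) * (x₀ * y₁ - x₁ * y₀)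
  -- This is det(S∂₀, ∂₁, N) + det(∂₀, S∂₁, N) = tr S · det(∂₀, ∂₁, N), where the last determinant
  -- is kε. The connection terms of S contribute nothing to the sum.
  trace : -(a₀ * (y₁ * c - w₁ * b) + b₀ * (w₁ * a - x₁ * c))
    + (a₁ * (y₀ * c - w₀ * b) + b₁ * (w₀ * a - x₀ * c)) = 2 * H * k * ε

namespace FrameEquations

variable {τ δ ε c H k a b x₀ x₁ y₀ y₁ w₀ w₁ a₀ a₁ b₀ b₁ : ℝ}

/-- The rotation speed `a bᵢ - b aᵢ` of the horizontal part of the normal. -/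
theorem rotation (h : FrameEquations τ δ ε c H k a b x₀ x₁ y₀ y₁ w₀ w₁ a₀ a₁ b₀ b₁)
    (hD : ε - δ * c ^ 2 ≠ 0) :
    a * b₀ - b * a₀ = 2 * τ * (δ * c ^ 2) * w₀ + 2 * H * (b * x₀ - a * y₀) ∧
    a * b₁ - b * a₁ = 2 * τ * (δ * c ^ 2) * w₁ + 2 * H * (b * x₁ - a * y₁) := by
  obtain ⟨hδ, hε, hu, hk, c1, c2, c3, n0, n1, u0, u1, hA, hT⟩ := h
  set D := a ^ 2 - δ * b ^ 2 with hDd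
  have hD0 : D ≠ 0 := by
    intro h0; apply hD; linarith
  have hε0 : ε ≠ 0 := by rintro rfl; norm_num at hε
  set P₀ := a * b₀ - b * a₀ with hP0
  set P₁ := a * b₁ - b * a₁ with hP1
  -- As a² − δb² is constant and nonzero, the derivatives of (a, b) are recovered from the rotation
  -- speeds `P₀`, `P₁`.
  have ea0 : D * a₀ = δ * b * P₀ := by linear_combination a * u0
  have ea1 : D * a₁ = δ * b * P₁ := by linear_combination a * u1
  have eb0 : D * b₀ = a * P₀ := by linear_combination b * u0
  have eb1 : D * b₁ = a * P₁ := by linear_combination b * u1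
  have hw : P₀ * w₁ - P₁ * w₀ = -2 * H * k * D := by
    apply mul_left_cancel₀ hε0
    have : D * (2 * H * k * ε) = -(ε * (P₀ * w₁ - P₁ * w₀)) := by
      rw [← hT, ← hu]
      linear_combination (-(y₁ * c - w₁ * b)) * ea0 - (w₁ * a - x₁ * c) * eb0
        + (y₀ * c - w₀ * b) * ea1 + (w₀ * a - x₀ * c) * eb1 + c * P₀ * n1 - c * P₁ * n0
    linear_combination this
  have hη : P₀ * (b * x₁ - a * y₁) - P₁ * (b * x₀ - a * y₀) = 2 * τ * (δ * c ^ 2) * k * D := by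
    have : D * (2 * τ * (δ * c) * (x₀ * y₁ - x₁ * y₀))
        = δ * (P₀ * (b * x₁ - a * y₁) - P₁ * (b * x₀ - a * y₀)) := by
      rw [← hA]
      linear_combination x₁ * ea0 - x₀ * ea1 - δ * y₁ * eb0 + δ * y₀ * eb1
    rw [c3] at this
    linear_combination (-δ) * this + (2 * τ * δ * c ^ 2 * k * D
      - (P₀ * (b * x₁ - a * y₁) - P₁ * (b * x₀ - a * y₀))) * hδ
  -- The forms θ and b dx − a dy are a coframe of the surface with wedge kD ≠ 0. `hw` and `hη` give
  -- the wedges of P with each of them, so Cramer's rule yields P.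
  have hωη : w₀ * (b * x₁ - a * y₁) - w₁ * (b * x₀ - a * y₀) = k * D := by
    linear_combination a * c1 + b * c2
  have hkD := mul_ne_zero hk hD0
  constructor <;> apply mul_left_cancel₀ hkD
  · linear_combination (-P₀) * hωη + w₀ * hη - (b * x₀ - a * y₀) * hw
  · linear_combination (-P₁) * hωη + w₁ * hη - (b * x₁ - a * y₁) * hw

theorem deriv_normal (h : FrameEquations τ δ ε c H k a b x₀ x₁ y₀ y₁ w₀ w₁ a₀ a₁ b₀ b₁)
    (hD : ε - δ * c ^ 2 ≠ 0) :
    ((ε - δ * c ^ 2) * a₀ = b * (δ * (2 * τ * (δ * c ^ 2) * w₀ + 2 * H * (b * x₀ - a * y₀))) ∧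
      (ε - δ * c ^ 2) * a₁ = b * (δ * (2 * τ * (δ * c ^ 2) * w₁ + 2 * H * (b * x₁ - a * y₁)))) ∧
    (ε - δ * c ^ 2) * b₀ = a * (2 * τ * (δ * c ^ 2) * w₀ + 2 * H * (b * x₀ - a * y₀)) ∧
    (ε - δ * c ^ 2) * b₁ = a * (2 * τ * (δ * c ^ 2) * w₁ + 2 * H * (b * x₁ - a * y₁)) := by
  obtain ⟨h0, h1⟩ := h.rotation hD
  rw [← h0, ← h1]
  have hu := h.unit
  have u0 := h.unit_fst
  have u1 := h.unit_snd
  refine ⟨⟨?_, ?_⟩, ?_, ?_⟩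
  · linear_combination a * u0 - a₀ * hu
  · linear_combination a * u1 - a₁ * hu
  · linear_combination b * u0 - b₀ * hu
  · linear_combination b * u1 - b₁ * hu

/-- If the normal is horizontal, then it varies like the horizontal position. -/
theorem deriv_normal_of_horizontal
    (h : FrameEquations τ δ ε 0 H k a b x₀ x₁ y₀ y₁ w₀ w₁ a₀ a₁ b₀ b₁) :
    (a₀ = -(2 * H) * x₀ ∧ a₁ = -(2 * H) * x₁) ∧ b₀ = -(2 * H) * y₀ ∧ b₁ = -(2 * H) * y₁ := by
  have hε0 : ε ≠ 0 := by
    have := h.eps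
    rintro rfl; norm_num at this
  obtain ⟨⟨ea0, ea1⟩, eb0, eb1⟩ := h.deriv_normal (by simpa using hε0)
  have hu := h.unit
  have n0 := h.normal_fst
  have n1 := h.normal_snd
  refine ⟨⟨?_, ?_⟩, ?_, ?_⟩ <;> apply mul_left_cancel₀ hε0
  · linear_combination ea0 - 2 * H * x₀ * hu + 2 * H * a * n0
  · linear_combination ea1 - 2 * H * x₁ * hu + 2 * H * a * n1
  · linear_combination eb0 - 2 * H * y₀ * hu + 2 * H * b * n0
  · linear_combination eb1 - 2 * H * y₁ * hu + 2 * H * b * n1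

/-- The integrability condition forced by a non-horizontal normal. -/
theorem sq_eq_of_closed (h : FrameEquations τ δ ε c H k a b x₀ x₁ y₀ y₁ w₀ w₁ a₀ a₁ b₀ b₁)
    (hD : ε - δ * c ^ 2 ≠ 0) (hc : c ≠ 0)
    (hd : 2 * τ * (δ * c ^ 2) * (2 * τ * (x₀ * y₁ - x₁ * y₀))
      + 2 * H * ((b₁ * x₀ - b₀ * x₁) - (a₁ * y₀ - a₀ * y₁)) = 0) :
    H ^ 2 = δ * τ ^ 2 * c ^ 2 := by
  obtain ⟨⟨ea0, ea1⟩, eb0, eb1⟩ := h.deriv_normal hD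
  have hδ0 : δ ≠ 0 := by
    have := h.delta
    rintro rfl; norm_num at this
  have hk := h.area
  apply mul_left_cancel₀ (mul_ne_zero (mul_ne_zero (mul_ne_zero hk hδ0) hc) hD)
  have c1 := h.cross_fst
  have c2 := h.cross_snd
  have c3 := h.cross_thd
  have n0 := h.normal_fst
  have n1 := h.normal_snd
  have hu := h.unit
  set Q₀ := 2 * τ * (δ * c ^ 2) * w₀ + 2 * H * (b * x₀ - a * y₀) with hQ0
  set Q₁ := 2 * τ * (δ * c ^ 2) * w₁ + 2 * H * (b * x₁ - a * y₁) with hQ1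
  have hQw : Q₀ * w₁ - Q₁ * w₀ = -2 * H * k * (ε - δ * c ^ 2) := by
    rw [hQ0, hQ1]
    linear_combination (-2 * H * b) * c2 - 2 * H * a * c1 + (-2 * H * k) * hu
  -- Here `hd` says that the form found in `rotation` is closed. The bracket is minus the exterior
  -- derivative of b dx − a dy, and the tangency relations reduce it to the wedge computed in `hQw`.
  have hη : (ε - δ * c ^ 2) * ((b₁ * x₀ - b₀ * x₁) - (a₁ * y₀ - a₀ * y₁))
      = δ * c * (Q₀ * w₁ - Q₁ * w₀) := by
    linear_combination x₀ * eb1 - x₁ * eb0 - y₀ * ea1 + y₁ * ea0 + Q₁ * n0 - Q₀ * n1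
  rw [hQw] at hη
  rw [c3] at hd
  linear_combination (-(ε - δ * c ^ 2) / 4) * hd + (H / 2) * hη

/-- The mean curvature where the normal has a non-zero null horizontal part. -/
theorem sq_eq_of_null (h : FrameEquations τ 1 ε c H k a b x₀ x₁ y₀ y₁ w₀ w₁ a₀ a₁ b₀ b₁)
    (hD : ε = c ^ 2) (hab : a ≠ 0 ∨ b ≠ 0) : H ^ 2 = τ ^ 2 * c ^ 2 := by
  obtain ⟨hδ, hε, hu, hk, c1, c2, c3, n0, n1, u0, u1, hA, hT⟩ := h
  -- ε is ±1 and equals a square.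
  have hc2 : c ^ 2 = 1 := by nlinarith [sq_nonneg c]
  have hsq : (a - b) * (a + b) = 0 := by linear_combination hu + hD
  rw [c3] at hA
  -- σ selects the null line containing (a, b). The derivatives lie on the same line, and then the
  -- left side of the trace equation is cσ times that of the closedness equation; comparing right
  -- sides gives H.
  have key : ∀ σ : ℝ, σ ^ 2 = 1 → a = σ * b → H ^ 2 = τ ^ 2 * c ^ 2 := by
    intro σ hσ hab'
    have hb : b ≠ 0 := by
      rintro rfl
      simp_all
    have e0 : a₀ = σ * b₀ := by
      apply mul_left_cancel₀ hb
      rw [hab'] at u0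
      linear_combination σ * u0 - b * a₀ * hσ
    have e1 : a₁ = σ * b₁ := by
      apply mul_left_cancel₀ hb
      rw [hab'] at u1
      linear_combination σ * u1 - b * a₁ * hσ
    have : H = τ * c * σ := by
      apply mul_left_cancel₀ (mul_ne_zero two_ne_zero hk)
      subst e0 e1 hab'
      rw [hD] at hT
      linear_combination (-1) * hT + c * σ * hA - 2 * H * k * hc2
        + 2 * k * τ * c * σ * hc2 - c * (b₀ * x₁ - b₁ * x₀) * hσ
    rw [this]
    linear_combination τ ^ 2 * c ^ 2 * hσ
  rcases mul_eq_zero.1 hsq with h | h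
  · exact key 1 (by norm_num) (by linarith)
  · exact key (-1) (by norm_num) (by linarith)

end FrameEquations

/-! ### Constant angle surfaces in local coordinates -/

/-- A constant angle surface of constant mean curvature, written in coordinates on the open set
`U` of the plane; `c` is the vertical component of the normal. -/
structure LocalHelix (τ δ ε c H : ℝ) (U : Set (Fin 2 → ℝ)) (G n : (Fin 2 → ℝ) → Fin 3 → ℝ) :
    Prop where
  isOpen : IsOpen U
  smooth : ContDiffOn ℝ ∞ G U
  normal_smooth : ContDiffOn ℝ ∞ n U
  immersion : ∀ p ∈ U, Function.Injective (fderiv ℝ G p)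
  eps : ε ^ 2 = 1
  unit : ∀ p ∈ U, ip τ δ (G p) (n p) (n p) = ε
  orthogonal : ∀ p ∈ U, ∀ X, ip τ δ (G p) (n p) (fderiv ℝ G p X) = 0
  vertical : ∀ p ∈ U, theta τ (G p) (n p) = c
  curvature : ∀ p ∈ U, ∃ S : (Fin 2 → ℝ) →ₗ[ℝ] (Fin 2 → ℝ),
    (∀ X, fderiv ℝ G p (S X) = -fun k => fderiv ℝ n p X k
      + ∑ i, ∑ j, christoffel (metric τ δ) k i j (G p) * fderiv ℝ G p X i * n p j) ∧
    (1 / 2) * LinearMap.trace ℝ (Fin 2 → ℝ) S = H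

/-- The value of the contact form on the `i`-th coordinate vector. -/
def verticalPart (τ : ℝ) (G : (Fin 2 → ℝ) → Fin 3 → ℝ) (i : Fin 2) (p : Fin 2 → ℝ) : ℝ :=
  partialD i (fun q => G q 2) p
    + τ * (G p 1 * partialD i (fun q => G q 0) p - G p 0 * partialD i (fun q => G q 1) p)

theorem fderiv_single_apply {G : (Fin 2 → ℝ) → Fin 3 → ℝ} {p : Fin 2 → ℝ}
    (hG : DifferentiableAt ℝ G p) (i : Fin 2) (j : Fin 3) :
    fderiv ℝ G p (Pi.single i 1) j = partialD i (fun q => G q j) p := by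
  rw [partialD, fderiv_apply hG]
  rfl

namespace LocalHelix

variable {τ δ ε c H : ℝ} {U : Set (Fin 2 → ℝ)} {G n : (Fin 2 → ℝ) → Fin 3 → ℝ} {p : Fin 2 → ℝ}

theorem contDiffAt (h : LocalHelix τ δ ε c H U G n) (hp : p ∈ U) (j : Fin 3) :
    ContDiffAt ℝ ∞ (fun q => G q j) p :=
  contDiffAt_pi.1 (h.smooth.contDiffAt (h.isOpen.mem_nhds hp)) j

theorem normal_contDiffAt (h : LocalHelix τ δ ε c H U G n) (hp : p ∈ U) (j : Fin 3) :
    ContDiffAt ℝ ∞ (fun q => n q j) p :=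
  contDiffAt_pi.1 (h.normal_smooth.contDiffAt (h.isOpen.mem_nhds hp)) j

theorem differentiableAt (h : LocalHelix τ δ ε c H U G n) (hp : p ∈ U) (j : Fin 3) :
    DifferentiableAt ℝ (fun q => G q j) p :=
  (h.contDiffAt hp j).differentiableAt (by simp)

theorem normal_differentiableAt (h : LocalHelix τ δ ε c H U G n) (hp : p ∈ U) (j : Fin 3) :
    DifferentiableAt ℝ (fun q => n q j) p :=
  (h.normal_contDiffAt hp j).differentiableAt (by simp)

theorem differentiableAt_partialD (h : LocalHelix τ δ ε c H U G n) (hp : p ∈ U) (i : Fin 2)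
    (j : Fin 3) : DifferentiableAt ℝ (fun q => partialD i (fun r => G r j) q) p :=
  (contDiffAt_partialD i (h.contDiffAt hp j)).differentiableAt (by simp)

theorem normal_differentiableAt_partialD (h : LocalHelix τ δ ε c H U G n) (hp : p ∈ U)
    (i : Fin 2) (j : Fin 3) : DifferentiableAt ℝ (fun q => partialD i (fun r => n r j) q) p :=
  (contDiffAt_partialD i (h.normal_contDiffAt hp j)).differentiableAt (by simp)

theorem fderiv_apply (h : LocalHelix τ δ ε c H U G n) (hp : p ∈ U) (i : Fin 2) (j : Fin 3) :
    fderiv ℝ G p (Pi.single i 1) j = partialD i (fun q => G q j) p :=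
  fderiv_single_apply ((h.smooth.contDiffAt (h.isOpen.mem_nhds hp)).differentiableAt (by simp)) i j

theorem normal_fderiv_apply (h : LocalHelix τ δ ε c H U G n) (hp : p ∈ U) (i : Fin 2)
    (j : Fin 3) : fderiv ℝ n p (Pi.single i 1) j = partialD i (fun q => n q j) p :=
  fderiv_single_apply
    ((h.normal_smooth.contDiffAt (h.isOpen.mem_nhds hp)).differentiableAt (by simp)) i j

theorem theta_fderiv (h : LocalHelix τ δ ε c H U G n) (hp : p ∈ U) (i : Fin 2) :
    theta τ (G p) (fderiv ℝ G p (Pi.single i 1)) = verticalPart τ G i p := by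
  simp only [theta, verticalPart, h.fderiv_apply hp]

theorem normal_eq (h : LocalHelix τ δ ε c H U G n) (hp : p ∈ U) (i : Fin 2) :
    n p 0 * partialD i (fun q => G q 0) p - δ * n p 1 * partialD i (fun q => G q 1) p
      + δ * c * verticalPart τ G i p = 0 := by
  have := h.orthogonal p hp (Pi.single i 1)
  rw [ip_eq, h.vertical p hp, h.theta_fderiv hp, h.fderiv_apply hp, h.fderiv_apply hp] at this
  linarith

theorem unit_eq (h : LocalHelix τ δ ε c H U G n) (hp : p ∈ U) :
    n p 0 * n p 0 - δ * (n p 1 * n p 1) + δ * (c * c) = ε := by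
  have := h.unit p hp
  rwa [ip_eq, h.vertical p hp] at this

theorem partialD_eq_zero (h : LocalHelix τ δ ε c H U G n) (hp : p ∈ U) (i : Fin 2)
    {f : (Fin 2 → ℝ) → ℝ} {r : ℝ} (hf : ∀ q ∈ U, f q = r) : partialD i f p = 0 := by
  rw [partialD_congr i (g := fun _ => r), partialD_const]
  filter_upwards [h.isOpen.mem_nhds hp] with q hq using hf q hq

theorem unit_deriv (h : LocalHelix τ δ ε c H U G n) (hp : p ∈ U) (i : Fin 2) :
    n p 0 * partialD i (fun q => n q 0) p = δ * (n p 1 * partialD i (fun q => n q 1) p) := by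
  have h0 := h.normal_differentiableAt hp 0
  have h1 := h.normal_differentiableAt hp 1
  have := h.partialD_eq_zero hp i (fun q hq => h.unit_eq hq)
  simp (disch := fun_prop) only [partialD_add, partialD_sub, partialD_mul, partialD_const] at this
  linarith

theorem vertical_deriv (h : LocalHelix τ δ ε c H U G n) (hp : p ∈ U) (i : Fin 2) :
    partialD i (fun q => n q 2) p
      + τ * (G p 1 * partialD i (fun q => n q 0) p - G p 0 * partialD i (fun q => n q 1) p)
      = τ * (n p 1 * partialD i (fun q => G q 0) p - n p 0 * partialD i (fun q => G q 1) p) := by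
  have h0 := h.normal_differentiableAt hp 0
  have h1 := h.normal_differentiableAt hp 1
  have h2 := h.normal_differentiableAt hp 2
  have g0 := h.differentiableAt hp 0
  have g1 := h.differentiableAt hp 1
  have := h.partialD_eq_zero hp i (fun q hq => h.vertical q hq)
  simp (disch := fun_prop) only [theta, partialD_add, partialD_sub, partialD_mul,
    partialD_const] at this
  linarith

theorem differentiableAt_verticalPart (h : LocalHelix τ δ ε c H U G n) (hp : p ∈ U) (i : Fin 2) :
    DifferentiableAt ℝ (verticalPart τ G i) p := by
  have g0 := h.differentiableAt hp 0
  have g1 := h.differentiableAt hp 1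
  have k0 := h.differentiableAt_partialD hp i 0
  have k1 := h.differentiableAt_partialD hp i 1
  have k2 := h.differentiableAt_partialD hp i 2
  unfold verticalPart
  fun_prop

/-- The exterior derivative of the contact form. -/
theorem verticalPart_closed (h : LocalHelix τ δ ε c H U G n) (hp : p ∈ U) :
    partialD 1 (verticalPart τ G 0) p - partialD 0 (verticalPart τ G 1) p =
      2 * τ * (partialD 0 (fun q => G q 0) p * partialD 1 (fun q => G q 1) p
        - partialD 1 (fun q => G q 0) p * partialD 0 (fun q => G q 1) p) := by
  have g0 := h.differentiableAt hp 0
  have g1 := h.differentiableAt hp 1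
  have k00 := h.differentiableAt_partialD hp 0 0
  have k01 := h.differentiableAt_partialD hp 0 1
  have k02 := h.differentiableAt_partialD hp 0 2
  have k10 := h.differentiableAt_partialD hp 1 0
  have k11 := h.differentiableAt_partialD hp 1 1
  have k12 := h.differentiableAt_partialD hp 1 2
  unfold verticalPart
  simp (disch := fun_prop) only [partialD_add, partialD_sub, partialD_mul, partialD_const]
  have e0 := partialD_comm 0 1 (h.contDiffAt hp 0)
  have e1 := partialD_comm 0 1 (h.contDiffAt hp 1)
  have e2 := partialD_comm 0 1 (h.contDiffAt hp 2)
  linear_combination (-1) * e2 - τ * G p 1 * e0 + τ * G p 0 * e1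

/-- Differentiate the tangency relation of each coordinate vector in the other direction and
subtract: the second derivatives of the immersion cancel, and only the exterior derivative of the
contact form remains. -/
theorem closed_eq (h : LocalHelix τ δ ε c H U G n) (hp : p ∈ U) :
    (partialD 0 (fun q => n q 0) p * partialD 1 (fun q => G q 0) p
        - partialD 1 (fun q => n q 0) p * partialD 0 (fun q => G q 0) p)
      - δ * (partialD 0 (fun q => n q 1) p * partialD 1 (fun q => G q 1) p
        - partialD 1 (fun q => n q 1) p * partialD 0 (fun q => G q 1) p)
      = 2 * τ * (δ * c) * (partialD 0 (fun q => G q 0) p * partialD 1 (fun q => G q 1) p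
        - partialD 1 (fun q => G q 0) p * partialD 0 (fun q => G q 1) p) := by
  have h0 := h.normal_differentiableAt hp 0
  have h1 := h.normal_differentiableAt hp 1
  have k00 := h.differentiableAt_partialD hp 0 0
  have k01 := h.differentiableAt_partialD hp 0 1
  have k10 := h.differentiableAt_partialD hp 1 0
  have k11 := h.differentiableAt_partialD hp 1 1
  have v0 := h.differentiableAt_verticalPart hp 0
  have v1 := h.differentiableAt_verticalPart hp 1
  have hw := h.verticalPart_closed hp
  have e1 := h.partialD_eq_zero hp 1 (fun q hq => h.normal_eq hq 0)
  have e0 := h.partialD_eq_zero hp 0 (fun q hq => h.normal_eq hq 1)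
  simp (disch := fun_prop) only [partialD_add, partialD_sub, partialD_mul, partialD_const] at e0 e1
  have s0 := partialD_comm 0 1 (h.contDiffAt hp 0)
  have s1 := partialD_comm 0 1 (h.contDiffAt hp 1)
  linear_combination e0 - e1 + δ * c * hw - n p 0 * s0 + δ * n p 1 * s1

theorem trace_toMatrix (S : (Fin 2 → ℝ) →ₗ[ℝ] (Fin 2 → ℝ)) :
    LinearMap.trace ℝ (Fin 2 → ℝ) S = S (Pi.single 0 1) 0 + S (Pi.single 1 1) 1 := by
  rw [LinearMap.trace_eq_matrix_trace ℝ (Pi.basisFun ℝ (Fin 2)), Matrix.trace, Fin.sum_univ_two]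
  simp

theorem fderiv_eq (X : Fin 2 → ℝ) :
    fderiv ℝ G p X
      = X 0 • fderiv ℝ G p (Pi.single 0 1) + X 1 • fderiv ℝ G p (Pi.single 1 1) := by
  conv_lhs => rw [← Finset.univ_sum_single X]
  rw [Fin.sum_univ_two, map_add, ← map_smul, ← map_smul, ← Pi.single_smul, ← Pi.single_smul]
  simp

/-- The coordinate vectors of the surface are linearly independent. -/
theorem eq_zero_of_comb (h : LocalHelix τ δ ε c H U G n) (hp : p ∈ U) {s t : ℝ}
    (h0 : s * partialD 0 (fun q => G q 0) p + t * partialD 1 (fun q => G q 0) p = 0)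
    (h1 : s * partialD 0 (fun q => G q 1) p + t * partialD 1 (fun q => G q 1) p = 0)
    (h2 : s * verticalPart τ G 0 p + t * verticalPart τ G 1 p = 0) : s = 0 ∧ t = 0 := by
  have : fderiv ℝ G p ![s, t] = fderiv ℝ G p 0 := by
    rw [fderiv_eq, map_zero]
    ext j
    simp only [Pi.add_apply, Pi.smul_apply, smul_eq_mul, h.fderiv_apply hp, Pi.zero_apply]
    revert j
    simp only [Fin.forall_fin_succ]
    refine ⟨by simpa using h0, by simpa using h1, ?_, fun i => i.elim0⟩
    simp only [verticalPart] at h2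
    simp
    linear_combination h2 - τ * G p 1 * h0 + τ * G p 0 * h1
  have := h.immersion p hp this
  exact ⟨congrFun this 0, congrFun this 1⟩

theorem frameEquations (h : LocalHelix τ δ ε c H U G n) (hδ : δ ^ 2 = 1) (hp : p ∈ U) :
    ∃ k, FrameEquations τ δ ε c H k (n p 0) (n p 1)
      (partialD 0 (fun q => G q 0) p) (partialD 1 (fun q => G q 0) p)
      (partialD 0 (fun q => G q 1) p) (partialD 1 (fun q => G q 1) p)
      (verticalPart τ G 0 p) (verticalPart τ G 1 p)
      (partialD 0 (fun q => n q 0) p) (partialD 1 (fun q => n q 0) p)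
      (partialD 0 (fun q => n q 1) p) (partialD 1 (fun q => n q 1) p) := by
  have hc0 := h.eq_zero_of_comb hp (s := partialD 1 (fun q => G q 0) p)
    (t := -partialD 0 (fun q => G q 0) p)
  have hc1 := h.eq_zero_of_comb hp (s := partialD 1 (fun q => G q 1) p)
    (t := -partialD 0 (fun q => G q 1) p)
  have hc2 := h.eq_zero_of_comb hp (s := verticalPart τ G 1 p) (t := -verticalPart τ G 0 p)
  have hc3 := h.eq_zero_of_comb hp (s := 1) (t := 0)
  have hA := h.closed_eq hp
  have hu := h.unit_eq hp
  have u0 := h.unit_deriv hp 0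
  have u1 := h.unit_deriv hp 1
  have n0 := h.normal_eq hp 0
  have n1 := h.normal_eq hp 1
  have v0 := h.vertical_deriv hp 0
  have v1 := h.vertical_deriv hp 1
  have hv := h.vertical p hp
  obtain ⟨S, hS, htr⟩ := h.curvature p hp
  rw [trace_toMatrix] at htr
  have hS' : ∀ i : Fin 2, ∀ j : Fin 3,
      S (Pi.single i 1) 0 * partialD 0 (fun q => G q j) p
        + S (Pi.single i 1) 1 * partialD 1 (fun q => G q j) p
      = -(partialD i (fun q => n q j) p +
        ![δ * τ * (n p 1 * verticalPart τ G i p + c * partialD i (fun q => G q 1) p),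
        τ * (n p 0 * verticalPart τ G i p + c * partialD i (fun q => G q 0) p),
        τ * G p 0 * (τ * (n p 0 * verticalPart τ G i p + c * partialD i (fun q => G q 0) p))
          - τ * G p 1 * (δ * τ * (n p 1 * verticalPart τ G i p
            + c * partialD i (fun q => G q 1) p))] j) := by
    intro i j
    have e1 := congrFun (hS (Pi.single i 1)) j
    rw [fderiv_eq] at e1
    have e2 := congrFun (christoffel_contract τ hδ (G p) (fderiv ℝ G p (Pi.single i 1)) (n p)) j
    simp only [Pi.neg_apply] at e1
    rw [e2, hv] at e1
    simpa only [Pi.add_apply, Pi.smul_apply, smul_eq_mul, h.fderiv_apply hp, h.theta_fderiv hp,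
      h.normal_fderiv_apply hp] using e1
  have t00 := hS' 0 0
  have t01 := hS' 0 1
  have t02 := hS' 0 2
  have t10 := hS' 1 0
  have t11 := hS' 1 1
  have t12 := hS' 1 2
  clear hS hS'
  simp only [Matrix.cons_val] at t00 t01 t02 t10 t11 t12
  -- The contact form vanishes on the Christoffel term of `christoffel_contract`, so the vertical
  -- part of S∂ᵢ comes only from differentiating N, where constancy of `c` replaces the derivatives
  -- of N by those of F.
  have w0 : S (Pi.single 0 1) 0 * verticalPart τ G 0 p + S (Pi.single 0 1) 1 * verticalPart τ G 1 p
      = -(τ * (n p 1 * partialD 0 (fun q => G q 0) p - n p 0 * partialD 0 (fun q => G q 1) p)) := by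
    simp only [verticalPart] at t00 t01 t02 ⊢
    linear_combination t02 + τ * G p 1 * t00 - τ * G p 0 * t01 - v0
  have w1 : S (Pi.single 1 1) 0 * verticalPart τ G 0 p + S (Pi.single 1 1) 1 * verticalPart τ G 1 p
      = -(τ * (n p 1 * partialD 1 (fun q => G q 0) p - n p 0 * partialD 1 (fun q => G q 1) p)) := by
    simp only [verticalPart] at t10 t11 t12 ⊢
    linear_combination t12 + τ * G p 1 * t10 - τ * G p 0 * t11 - v1
  clear t02 t12 v0 v1
  have hε := h.eps
  generalize S (Pi.single 0 1) 0 = s00 at *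
  generalize S (Pi.single 0 1) 1 = s10 at *
  generalize S (Pi.single 1 1) 0 = s01 at *
  generalize S (Pi.single 1 1) 1 = s11 at *
  generalize verticalPart τ G 0 p = w₀ at *
  generalize verticalPart τ G 1 p = w₁ at *
  generalize partialD 0 (fun q => G q 0) p = x₀ at *
  generalize partialD 1 (fun q => G q 0) p = x₁ at *
  generalize partialD 0 (fun q => G q 1) p = y₀ at *
  generalize partialD 1 (fun q => G q 1) p = y₁ at *
  generalize partialD 0 (fun q => n q 0) p = a₀ at *
  generalize partialD 1 (fun q => n q 0) p = a₁ at *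
  generalize partialD 0 (fun q => n q 1) p = b₀ at *
  generalize partialD 1 (fun q => n q 1) p = b₁ at *
  generalize n p 0 = a at *
  generalize n p 1 = b at *
  -- The factor is forced: contracting the cross product with N gives kε, and ε is its own inverse.
  set k := ε * ((y₀ * w₁ - y₁ * w₀) * a + (w₀ * x₁ - w₁ * x₀) * b + (x₀ * y₁ - x₁ * y₀) * c)
    with hk
  have c1 : y₀ * w₁ - y₁ * w₀ = k * a := by
    rw [hk]
    linear_combination ε * (b * w₁ - c * y₁) * n0 - ε * (b * w₀ - c * y₀) * n1
      - ε * (y₀ * w₁ - y₁ * w₀) * hu - (y₀ * w₁ - y₁ * w₀) * hε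
  have c2 : w₀ * x₁ - w₁ * x₀ = -(k * (δ * b)) := by
    rw [hk]
    linear_combination ε * (c * x₁ - a * w₁) * n0 - ε * (c * x₀ - a * w₀) * n1
      - ε * (w₀ * x₁ - w₁ * x₀) * hu - (w₀ * x₁ - w₁ * x₀) * hε
  have c3 : x₀ * y₁ - x₁ * y₀ = k * (δ * c) := by
    rw [hk]
    linear_combination ε * (a * y₁ - b * x₁) * n0 - ε * (a * y₀ - b * x₀) * n1
      - ε * (x₀ * y₁ - x₁ * y₀) * hu - (x₀ * y₁ - x₁ * y₀) * hε
  refine ⟨k, hδ, hε, by linarith, ?_, c1, c2, c3, n0, n1, u0, u1, hA, ?_⟩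
  -- If `k` were zero, all 2×2 minors of the coordinate vectors would vanish; linear independence
  -- then makes every component of the first vector zero, a contradiction.
  · clear_value k
    rintro rfl
    obtain ⟨-, hx⟩ := hc0 (by ring) (by linear_combination -c3) (by linear_combination c2)
    obtain ⟨-, hy⟩ := hc1 (by linear_combination c3) (by ring) (by linear_combination -c1)
    obtain ⟨-, hw⟩ := hc2 (by linear_combination -c2) (by linear_combination c1) (by ring)
    have := hc3 (by linarith) (by linarith) (by linarith)
    exact one_ne_zero this.1
  · clear_value k
    linear_combination (-(y₁ * c - w₁ * b)) * t00 - (w₁ * a - x₁ * c) * t01 - (x₁ * b - y₁ * a) * w0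
      + (y₀ * c - w₀ * b) * t10 + (w₀ * a - x₀ * c) * t11 + (x₀ * b - y₀ * a) * w1
      + (s00 + s11) * (a * c1 + b * c2 + c * c3 + k * hu) + 2 * k * ε * htr
      - 2 * τ * δ * b * c * c1 - 2 * τ * a * c * c2

end LocalHelix

/-! ### Integrability conditions for constant angle surfaces of constant mean curvature -/

namespace LocalHelix

variable {τ δ ε c H : ℝ} {U : Set (Fin 2 → ℝ)} {G n : (Fin 2 → ℝ) → Fin 3 → ℝ} {p : Fin 2 → ℝ}

theorem eqOn_partialD (h : LocalHelix τ δ ε c H U G n) (hp : p ∈ U) (i : Fin 2)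
    {f g : (Fin 2 → ℝ) → ℝ} (hf : ∀ q ∈ U, f q = g q) : partialD i f p = partialD i g p := by
  apply partialD_congr
  filter_upwards [h.isOpen.mem_nhds hp] with q hq using hf q hq

/-- A constant angle surface of constant mean curvature whose normal is neither horizontal nor has
a null horizontal part satisfies `H² = δ τ² c²`. -/
theorem sq_eq_of_ne (h : LocalHelix τ δ ε c H U G n) (hδ : δ ^ 2 = 1) (hp : p ∈ U)
    (hD : ε - δ * c ^ 2 ≠ 0) (hc : c ≠ 0) : H ^ 2 = δ * τ ^ 2 * c ^ 2 := by
  obtain ⟨k, hk⟩ := h.frameEquations hδ hp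
  apply hk.sq_eq_of_closed hD hc
  have hder := fun q (hq : q ∈ U) => (h.frameEquations hδ hq).choose_spec.deriv_normal hD
  have h0 := h.normal_differentiableAt hp 0
  have h1 := h.normal_differentiableAt hp 1
  have k00 := h.differentiableAt_partialD hp 0 0
  have k01 := h.differentiableAt_partialD hp 0 1
  have k10 := h.differentiableAt_partialD hp 1 0
  have k11 := h.differentiableAt_partialD hp 1 1
  have m00 := h.normal_differentiableAt_partialD hp 0 0
  have m01 := h.normal_differentiableAt_partialD hp 0 1
  have m10 := h.normal_differentiableAt_partialD hp 1 0
  have m11 := h.normal_differentiableAt_partialD hp 1 1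
  have v0 := h.differentiableAt_verticalPart hp 0
  have v1 := h.differentiableAt_verticalPart hp 1
  have hw := h.verticalPart_closed hp
  have ea0 := h.eqOn_partialD hp 1 (fun q hq => (hder q hq).1.1)
  have ea1 := h.eqOn_partialD hp 0 (fun q hq => (hder q hq).1.2)
  have eb0 := h.eqOn_partialD hp 1 (fun q hq => (hder q hq).2.1)
  have eb1 := h.eqOn_partialD hp 0 (fun q hq => (hder q hq).2.2)
  simp (disch := fun_prop) only [partialD_add, partialD_sub, partialD_mul, partialD_const]
    at ea0 ea1 eb0 eb1
  have s0 := partialD_comm 0 1 (h.contDiffAt hp 0)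
  have s1 := partialD_comm 0 1 (h.contDiffAt hp 1)
  have r0 := partialD_comm 0 1 (h.normal_contDiffAt hp 0)
  have r1 := partialD_comm 0 1 (h.normal_contDiffAt hp 1)
  obtain ⟨⟨da0, da1⟩, db0, db1⟩ := hder p hp
  have hu := h.unit_eq hp
  have hw' : 2 * τ * (partialD 0 (fun q => G q 0) p * partialD 1 (fun q => G q 1) p
        - partialD 1 (fun q => G q 0) p * partialD 0 (fun q => G q 1) p)
      = partialD 1 (verticalPart τ G 0) p - partialD 0 (verticalPart τ G 1) p := hw.symm
  rw [hw']
  clear hw hw' hk hder v0 v1 h0 h1 k00 k01 k10 k11 m00 m01 m10 m11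
  generalize partialD 1 (verticalPart τ G 0) p = w01 at *
  generalize partialD 0 (verticalPart τ G 1) p = w10 at *
  generalize verticalPart τ G 0 p = w₀ at *
  generalize verticalPart τ G 1 p = w₁ at *
  rw [← s0, ← s1, ← r0] at *
  rw [← r1] at *
  generalize partialD 0 (partialD 1 fun q => G q 0) p = x01 at *
  generalize partialD 0 (partialD 1 fun q => G q 1) p = y01 at *
  generalize partialD 0 (partialD 1 fun q => n q 0) p = a01 at *
  generalize partialD 0 (partialD 1 fun q => n q 1) p = b01 at *
  generalize partialD 0 (fun q => G q 0) p = x₀ at *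
  generalize partialD 1 (fun q => G q 0) p = x₁ at *
  generalize partialD 0 (fun q => G q 1) p = y₀ at *
  generalize partialD 1 (fun q => G q 1) p = y₁ at *
  generalize partialD 0 (fun q => n q 0) p = a₀ at *
  generalize partialD 1 (fun q => n q 0) p = a₁ at *
  generalize partialD 0 (fun q => n q 1) p = b₀ at *
  generalize partialD 1 (fun q => n q 1) p = b₁ at *
  generalize n p 0 = a at *
  generalize n p 1 = b at *
  set Q₀ := 2 * τ * (δ * c ^ 2) * w₀ + 2 * H * (b * x₀ - a * y₀) with hQ0
  set Q₁ := 2 * τ * (δ * c ^ 2) * w₁ + 2 * H * (b * x₁ - a * y₁) with hQ1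
  -- E = ∂₁Q₀ − ∂₀Q₁ for the 1-form Q of `deriv_normal`. Equality of the mixed second derivatives of
  -- a and of b yields bE = 0 and aE = 0, and a² − δb² ≠ 0 then gives E = 0.
  set E := 2 * τ * (δ * c ^ 2) * (w01 - w10)
      + 2 * H * ((b₁ * x₀ - b₀ * x₁) - (a₁ * y₀ - a₀ * y₁)) with hE
  have hbE : b * E = 0 := by
    apply mul_left_cancel₀ hD
    linear_combination (-δ * (ε - δ * c ^ 2)) * (ea0 - ea1) - Q₀ * db1 + Q₁ * db0
      - (ε - δ * c ^ 2) * ((b₁ * Q₀ - b₀ * Q₁) + b * E) * hδ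
  have haE : a * E = 0 := by
    apply mul_left_cancel₀ hD
    linear_combination (-(ε - δ * c ^ 2)) * (eb0 - eb1) - Q₀ * da1 + Q₁ * da0
  apply mul_left_cancel₀ hD
  linear_combination a * haE - δ * b * hbE - E * hu

/-- If the horizontal part of the normal is not null, H² = δτ²c² excludes δ = −1 by sign. If it is
null, it is nonzero at some point: for δ = −1 this contradicts definiteness, and for δ = 1
`sq_eq_of_null` applies there. -/
theorem eq_one_of_tilted (h : LocalHelix τ δ ε c H U G n) (hτ : τ ≠ 0) (hδ : δ = 1 ∨ δ = -1)
    (hU : U.Nonempty) (hc : c ≠ 0) : δ = 1 ∧ H ^ 2 = τ ^ 2 * c ^ 2 := by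
  obtain ⟨p, hp⟩ := hU
  have hδ2 : δ ^ 2 = 1 := by rcases hδ with rfl | rfl <;> norm_num
  by_cases hD : ε - δ * c ^ 2 = 0
  -- Otherwise N = cE₃ throughout, and the surface would be an integral surface of the contact
  -- distribution; `closed` would force τc²k = 0.
  · have hex : ∃ q ∈ U, n q 0 ≠ 0 ∨ n q 1 ≠ 0 := by
      by_contra! hcon
      obtain ⟨k, hk⟩ := h.frameEquations hδ2 hp
      have hA := hk.closed
      rw [hk.cross_thd, h.partialD_eq_zero hp 0 (fun q hq => (hcon q hq).1),
        h.partialD_eq_zero hp 1 (fun q hq => (hcon q hq).1),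
        h.partialD_eq_zero hp 0 (fun q hq => (hcon q hq).2),
        h.partialD_eq_zero hp 1 (fun q hq => (hcon q hq).2)] at hA
      have : τ * c ^ 2 * k = 0 := by linear_combination (-1 / 2) * hA - τ * c ^ 2 * k * hδ2
      have := hk.area
      simp_all
    obtain ⟨q, hq, hne⟩ := hex
    obtain ⟨k, hk⟩ := h.frameEquations hδ2 hq
    rcases hδ with rfl | rfl
    · exact ⟨rfl, hk.sq_eq_of_null (by linarith) hne⟩
    · exfalso
      have hu := hk.unit
      have h0 : n q 0 ^ 2 + n q 1 ^ 2 = 0 := by linarith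
      have : n q 0 = 0 := by nlinarith [sq_nonneg (n q 0), sq_nonneg (n q 1)]
      have : n q 1 = 0 := by nlinarith [sq_nonneg (n q 0), sq_nonneg (n q 1)]
      simp_all
  · have hH := h.sq_eq_of_ne hδ2 hp hD hc
    rcases hδ with rfl | rfl
    · exact ⟨rfl, by linarith⟩
    · exfalso
      have : 0 < τ ^ 2 * c ^ 2 := by positivity
      nlinarith [sq_nonneg H]

/-- If the normal is horizontal, then `N + 2 H F` has constant horizontal part. -/
theorem fderiv_eq_zero_of_horizontal (h : LocalHelix τ δ ε 0 H U G n) (hδ : δ ^ 2 = 1)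
    (hp : p ∈ U) : fderiv ℝ (fun q => n q 0 + 2 * H * G q 0) p = 0 ∧
      fderiv ℝ (fun q => n q 1 + 2 * H * G q 1) p = 0 := by
  obtain ⟨k, hk⟩ := h.frameEquations hδ hp
  obtain ⟨⟨a0, a1⟩, b0, b1⟩ := hk.deriv_normal_of_horizontal
  have h0 := h.normal_differentiableAt hp 0
  have h1 := h.normal_differentiableAt hp 1
  have g0 := h.differentiableAt hp 0
  have g1 := h.differentiableAt hp 1
  constructor <;> ext v <;> rw [fderiv_apply_eq_sum, Fin.sum_univ_two] <;>
    simp (disch := fun_prop) only [partialD_add, partialD_mul, partialD_const]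
  · rw [a0, a1, zero_apply]
    ring
  · rw [b0, b1, zero_apply]
    ring

end LocalHelix

/-! ### Passing from surfaces to coordinates -/

section Charts

variable {M : Type*} [TopologicalSpace M] [ChartedSpace (Fin 2 → ℝ) M]

theorem theta_E3 (τ : ℝ) (p : Fin 3 → ℝ) : theta τ p E3 = 1 := by
  simp [theta, E3]

theorem diff_eq_fderiv (P : (Fin 2 → ℝ) → Fin 3 → ℝ) (w : Fin 2 → ℝ) :
    diff P w = fderiv ℝ P w :=
  mfderiv_eq_fderiv

theorem mdifferentiable_symm_of_mem_maximalAtlas {e : OpenPartialHomeomorph M (Fin 2 → ℝ)}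
    (he : e ∈ IsManifold.maximalAtlas 𝓘(ℝ, Fin 2 → ℝ) ∞ M) :
    e.symm.MDifferentiable 𝓘(ℝ, Fin 2 → ℝ) 𝓘(ℝ, Fin 2 → ℝ) :=
  ⟨(contMDiffOn_symm_of_mem_maximalAtlas he).mdifferentiableOn (by simp),
    (contMDiffOn_of_mem_maximalAtlas he).mdifferentiableOn (by simp)⟩

/-- A chart identifies the tangent spaces of the surface with the plane. -/
def tangentEquiv {e : OpenPartialHomeomorph M (Fin 2 → ℝ)}
    (he : e ∈ IsManifold.maximalAtlas 𝓘(ℝ, Fin 2 → ℝ) ∞ M) {w : Fin 2 → ℝ} (hw : w ∈ e.target) :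
    (Fin 2 → ℝ) ≃L[ℝ] TangentSpace 𝓘(ℝ, Fin 2 → ℝ) (e.symm w) :=
  (mdifferentiable_symm_of_mem_maximalAtlas he).mfderiv (x := w) hw

theorem fderiv_comp_symm {m : ℕ} {e : OpenPartialHomeomorph M (Fin 2 → ℝ)}
    (he : e ∈ IsManifold.maximalAtlas 𝓘(ℝ, Fin 2 → ℝ) ∞ M) {w : Fin 2 → ℝ} (hw : w ∈ e.target)
    {f : M → Fin m → ℝ}
    (hf : MDifferentiableAt 𝓘(ℝ, Fin 2 → ℝ) 𝓘(ℝ, Fin m → ℝ) f (e.symm w)) (X : Fin 2 → ℝ) :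
    fderiv ℝ (f ∘ e.symm) w X
      = mfderiv 𝓘(ℝ, Fin 2 → ℝ) 𝓘(ℝ, Fin m → ℝ) f (e.symm w) (tangentEquiv he hw X) := by
  have hc := mfderiv_comp (I := 𝓘(ℝ, Fin 2 → ℝ)) (I' := 𝓘(ℝ, Fin 2 → ℝ))
    (I'' := 𝓘(ℝ, Fin m → ℝ)) (g := f) (f := e.symm) w hf
    ((mdifferentiable_symm_of_mem_maximalAtlas he).mdifferentiableAt hw)
  rw [mfderiv_eq_fderiv] at hc
  rw [hc]
  rfl

/-- The differential of a map to `ℝ³` in a chart. -/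
theorem exists_tangent_equiv {e : OpenPartialHomeomorph M (Fin 2 → ℝ)}
    (he : e ∈ IsManifold.maximalAtlas 𝓘(ℝ, Fin 2 → ℝ) ∞ M) {w : Fin 2 → ℝ} (hw : w ∈ e.target) :
    ∃ A : (Fin 2 → ℝ) ≃L[ℝ] TangentSpace 𝓘(ℝ, Fin 2 → ℝ) (e.symm w),
      ∀ f : M → Fin 3 → ℝ, ContMDiff 𝓘(ℝ, Fin 2 → ℝ) 𝓘(ℝ, Fin 3 → ℝ) ∞ f →
        ∀ X, fderiv ℝ (f ∘ e.symm) w X = diff f (e.symm w) (A X) :=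
  ⟨tangentEquiv he hw, fun _ hf X =>
    fderiv_comp_symm he hw ((hf (e.symm w)).mdifferentiableAt (by simp)) X⟩

theorem contDiffOn_comp_symm {m : ℕ} {e : OpenPartialHomeomorph M (Fin 2 → ℝ)}
    (he : e ∈ IsManifold.maximalAtlas 𝓘(ℝ, Fin 2 → ℝ) ∞ M) {f : M → Fin m → ℝ}
    (hf : ContMDiff 𝓘(ℝ, Fin 2 → ℝ) 𝓘(ℝ, Fin m → ℝ) ∞ f) :
    ContDiffOn ℝ ∞ (f ∘ e.symm) e.target := by
  rw [← contMDiffOn_iff_contDiffOn]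
  exact hf.comp_contMDiffOn (contMDiffOn_symm_of_mem_maximalAtlas he)

/-- The angle function is εδ times the vertical component of N, so that component is the constant
εδν, whose square is ν². -/
theorem IsHelixSurface.localHelix {τ δ ε ν H : ℝ} {F N : M → Fin 3 → ℝ} (hδ : δ ^ 2 = 1)
    (h : IsHelixSurface τ δ ε ν F N) (hH : HasConstantMeanCurvature τ δ F N H)
    {e : OpenPartialHomeomorph M (Fin 2 → ℝ)}
    (he : e ∈ IsManifold.maximalAtlas 𝓘(ℝ, Fin 2 → ℝ) ∞ M) :
    LocalHelix τ δ ε (ε * δ * ν) H e.target (F ∘ e.symm) (N ∘ e.symm) := by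
  have hε : ε ^ 2 = 1 := by rcases h.sign with h | h <;> rw [h] <;> norm_num
  refine ⟨e.open_target, contDiffOn_comp_symm he h.smooth, contDiffOn_comp_symm he h.normal_smooth,
    fun w hw => ?_, hε, fun w hw => h.normal_unit _, fun w hw X => ?_, fun w hw => ?_,
    fun w hw => ?_⟩
  · obtain ⟨A, hA⟩ := exists_tangent_equiv he hw
    intro X Y hXY
    rw [hA F h.smooth, hA F h.smooth] at hXY
    exact A.injective (h.immersion _ hXY)
  · obtain ⟨A, hA⟩ := exists_tangent_equiv he hw
    rw [hA F h.smooth]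
    exact h.normal_orthogonal _ _
  · have := h.angle (e.symm w)
    rw [ip_eq, theta_E3] at this
    simp only [E3, Matrix.cons_val] at this
    simp only [Function.comp]
    linear_combination ε * δ * this - theta τ (F (e.symm w)) (N (e.symm w)) * (δ ^ 2 * hε + hδ)
  · obtain ⟨A, hA⟩ := exists_tangent_equiv he hw
    obtain ⟨S, hS, htr⟩ := hH (e.symm w)
    refine ⟨A.symm.toLinearEquiv.conj S, fun X => ?_, ?_⟩
    · rw [hA F h.smooth, hA N h.normal_smooth, hA F h.smooth]
      have : A (A.symm.toLinearEquiv.conj S X) = S (A X) := by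
        simp [LinearEquiv.conj_apply]
      rw [this, hS]
      rfl
    · rw [LinearMap.trace_conj', htr]

/-- A zero derivative makes the function constant on small chart balls, hence locally constant,
hence constant by connectedness. -/
theorem exists_const_of_fderiv_eq_zero [ConnectedSpace M] (f : M → ℝ)
    (hf : ∀ p, ∀ w ∈ (chartAt (Fin 2 → ℝ) p).target,
      DifferentiableAt ℝ (fun x => f ((chartAt (Fin 2 → ℝ) p).symm x)) w ∧
      fderiv ℝ (fun x => f ((chartAt (Fin 2 → ℝ) p).symm x)) w = 0) :
    ∃ r, ∀ q, f q = r := by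
  have hl : IsLocallyConstant f := by
    rw [IsLocallyConstant.iff_eventually_eq]
    intro p
    set e := chartAt (Fin 2 → ℝ) p
    have hp := mem_chart_source (Fin 2 → ℝ) p
    obtain ⟨ρ, hρ, hball⟩ := Metric.isOpen_iff.1 e.open_target (e p) (e.map_source hp)
    have hnhds : e ⁻¹' Metric.ball (e p) ρ ∈ 𝓝 p :=
      (e.continuousAt hp).preimage_mem_nhds (Metric.ball_mem_nhds _ hρ)
    filter_upwards [hnhds, e.open_source.mem_nhds hp] with q hq hq'
    have := (convex_ball (e p) ρ).is_const_of_fderivWithin_eq_zero (𝕜 := ℝ)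
      (f := fun x => f (e.symm x))
      (fun x hx => (hf p x (hball hx)).1.differentiableWithinAt)
      (fun x hx => by
        rw [fderivWithin_of_isOpen Metric.isOpen_ball hx]
        exact (hf p x (hball hx)).2) hq (Metric.mem_ball_self hρ)
    simpa only [e.left_inv hq', e.left_inv hp] using this
  obtain ⟨p⟩ := (inferInstance : Nonempty M)
  exact ⟨f p, fun q => hl.apply_eq_of_isPreconnected isPreconnected_univ trivial trivial⟩

/-- On a constant angle surface with `ν = 0` the horizontal part of the normal is a unit vector. -/
theorem IsHelixSurface.unit_of_zero {τ δ ε : ℝ} {F N : M → Fin 3 → ℝ}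
    (hδ : δ = 1 ∨ δ = -1) (h : IsHelixSurface τ δ ε 0 F N) (q : M) :
    N q 0 ^ 2 - δ * N q 1 ^ 2 = ε ∧ theta τ (F q) (N q) = 0 := by
  have hδ0 : δ ≠ 0 := by rcases hδ with rfl | rfl <;> norm_num
  have hε0 : ε ≠ 0 := by rcases h.sign with h | h <;> rw [h] <;> norm_num
  have h1 := h.angle q
  rw [ip_eq, theta_E3] at h1
  simp [E3, hε0, hδ0] at h1
  have h2 := h.normal_unit q
  rw [ip_eq, h1] at h2
  exact ⟨by linarith, h1⟩

variable [IsManifold 𝓘(ℝ, Fin 2 → ℝ) ∞ M]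

/-- A constant angle surface of constant mean curvature with `ν ≠ 0`. -/
theorem IsHelixSurface.eq_one_of_ne_zero [Nonempty M] {τ δ ε ν H : ℝ} {F N : M → Fin 3 → ℝ}
    (hτ : τ ≠ 0) (hδ : δ = 1 ∨ δ = -1) (h : IsHelixSurface τ δ ε ν F N)
    (hH : HasConstantMeanCurvature τ δ F N H) (hν : ν ≠ 0) : δ = 1 ∧ H ^ 2 = τ ^ 2 * ν ^ 2 := by
  obtain ⟨p⟩ := (inferInstance : Nonempty M)
  have hδ2 : δ ^ 2 = 1 := by rcases hδ with rfl | rfl <;> norm_num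
  have hε : ε ^ 2 = 1 := by rcases h.sign with h | h <;> rw [h] <;> norm_num
  have hl := h.localHelix hδ2 hH (IsManifold.chart_mem_maximalAtlas p)
  have hδ0 : δ ≠ 0 := by rintro rfl; norm_num at hδ2
  have hε0 : ε ≠ 0 := by rintro rfl; norm_num at hε
  obtain ⟨h1, h2⟩ := hl.eq_one_of_tilted hτ hδ
    ⟨_, (chartAt (Fin 2 → ℝ) p).map_source (mem_chart_source _ p)⟩
    (mul_ne_zero (mul_ne_zero hε0 hδ0) hν)
  refine ⟨h1, ?_⟩
  rw [h2]
  linear_combination τ ^ 2 * ν ^ 2 * (δ ^ 2 * hε + hδ2)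

/-- On a constant angle surface of constant mean curvature with `ν = 0`, the horizontal part of
`N + 2 H F` is constant. -/
theorem IsHelixSurface.exists_center [ConnectedSpace M] {τ δ ε H : ℝ} {F N : M → Fin 3 → ℝ}
    (hδ : δ = 1 ∨ δ = -1) (h : IsHelixSurface τ δ ε 0 F N)
    (hH : HasConstantMeanCurvature τ δ F N H) :
    ∃ α β : ℝ, ∀ q, N q 0 + 2 * H * F q 0 = α ∧ N q 1 + 2 * H * F q 1 = β := by
  have hδ2 : δ ^ 2 = 1 := by rcases hδ with rfl | rfl <;> norm_num
  have hl : ∀ p, LocalHelix τ δ ε 0 H (chartAt (Fin 2 → ℝ) p).target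
      (F ∘ (chartAt (Fin 2 → ℝ) p).symm) (N ∘ (chartAt (Fin 2 → ℝ) p).symm) := fun p => by
    simpa using h.localHelix hδ2 hH (IsManifold.chart_mem_maximalAtlas p)
  obtain ⟨α, hα⟩ := exists_const_of_fderiv_eq_zero (fun q => N q 0 + 2 * H * F q 0)
    fun p w hw => ⟨((hl p).normal_differentiableAt hw 0).add
      (((hl p).differentiableAt hw 0).const_mul _), ((hl p).fderiv_eq_zero_of_horizontal hδ2 hw).1⟩
  obtain ⟨β, hβ⟩ := exists_const_of_fderiv_eq_zero (fun q => N q 1 + 2 * H * F q 1)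
    fun p w hw => ⟨((hl p).normal_differentiableAt hw 1).add
      (((hl p).differentiableAt hw 1).const_mul _), ((hl p).fderiv_eq_zero_of_horizontal hδ2 hw).2⟩
  exact ⟨α, β, fun q => ⟨hα q, hβ q⟩⟩

end Charts

/-! ### Ambient isometries -/

/-- The composition of the half turn `(s x, s y, z)`, `s = ±1`, with the left translation by
`(x₀, y₀, 0)`. -/
def motionFun (τ s x₀ y₀ : ℝ) (p : Fin 3 → ℝ) : Fin 3 → ℝ :=
  ![s * p 0 + x₀, s * p 1 + y₀, p 2 + τ * (x₀ * (s * p 1) - y₀ * (s * p 0))]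

theorem motionFun_inv (τ x₀ y₀ : ℝ) {s : ℝ} (hs : s ^ 2 = 1) (p : Fin 3 → ℝ) :
    motionFun τ s (-(s * x₀)) (-(s * y₀)) (motionFun τ s x₀ y₀ p) = p := by
  ext j
  revert j
  simp only [Fin.forall_fin_succ]
  simp [motionFun]
  refine ⟨?_, ?_, ?_⟩ <;> grind

theorem motionFun_inv' (τ x₀ y₀ : ℝ) {s : ℝ} (hs : s ^ 2 = 1) (p : Fin 3 → ℝ) :
    motionFun τ s x₀ y₀ (motionFun τ s (-(s * x₀)) (-(s * y₀)) p) = p := by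
  ext j
  revert j
  simp only [Fin.forall_fin_succ]
  simp [motionFun]
  refine ⟨?_, ?_, ?_⟩ <;> grind

theorem contDiff_motionFun (τ s x₀ y₀ : ℝ) : ContDiff ℝ ∞ (motionFun τ s x₀ y₀) := by
  rw [contDiff_pi]
  simp only [Fin.forall_fin_succ, motionFun]
  refine ⟨?_, ?_, ?_, fun i => i.elim0⟩ <;> simp <;> fun_prop

theorem fderiv_motionFun (τ s x₀ y₀ : ℝ) (p v : Fin 3 → ℝ) :
    fderiv ℝ (motionFun τ s x₀ y₀) p v =
      ![s * v 0, s * v 1, v 2 + τ * (x₀ * (s * v 1) - y₀ * (s * v 0))] := by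
  have h0 := hasFDerivAt_coord 0 p
  have h1 := hasFDerivAt_coord 1 p
  have h2 := hasFDerivAt_coord 2 p
  have hd := ((contDiff_motionFun τ s x₀ y₀).differentiable (by simp)) p
  ext j
  have : fderiv ℝ (motionFun τ s x₀ y₀) p v j = fderiv ℝ (fun q => motionFun τ s x₀ y₀ q j) p v := by
    rw [fderiv_apply hd]; rfl
  rw [this]
  revert j
  simp only [Fin.forall_fin_succ]
  refine ⟨fun _ => ?_, fun _ => ?_, fun _ => ?_, fun i => i.elim0⟩
  · change fderiv ℝ (fun q => s * q 0 + x₀) p v = _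
    rw [((h0.const_mul s).add_const x₀).fderiv]
    simp
  · change fderiv ℝ (fun q => s * q 1 + y₀) p v = _
    rw [((h1.const_mul s).add_const y₀).fderiv]
    simp
  · change fderiv ℝ (fun q => q 2 + τ * (x₀ * (s * q 1) - y₀ * (s * q 0))) p v = _
    rw [(h2.fun_add ((((h1.const_mul s).const_mul x₀).fun_sub ((h0.const_mul s).const_mul y₀)).const_mul
      τ)).fderiv]
    simp

/-- The motion `motionFun` as a bijection. -/
def motion (τ x₀ y₀ : ℝ) {s : ℝ} (hs : s ^ 2 = 1) : (Fin 3 → ℝ) ≃ (Fin 3 → ℝ) where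
  toFun := motionFun τ s x₀ y₀
  invFun := motionFun τ s (-(s * x₀)) (-(s * y₀))
  left_inv := motionFun_inv τ x₀ y₀ hs
  right_inv := motionFun_inv' τ x₀ y₀ hs

theorem isAmbientIsometry_motion (τ δ x₀ y₀ : ℝ) {s : ℝ} (hs : s ^ 2 = 1) :
    IsAmbientIsometry τ δ (motion τ x₀ y₀ hs) where
  smooth := contDiff_motionFun _ _ _ _
  smooth_symm := contDiff_motionFun _ _ _ _
  preserves p v w := by
    change ip τ δ (motionFun τ s x₀ y₀ p) (fderiv ℝ (motionFun τ s x₀ y₀) p v)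
      (fderiv ℝ (motionFun τ s x₀ y₀) p w) = _
    rw [fderiv_motionFun, fderiv_motionFun, ip_eq, ip_eq]
    have ht : ∀ v, theta τ (motionFun τ s x₀ y₀ p)
        ![s * v 0, s * v 1, v 2 + τ * (x₀ * (s * v 1) - y₀ * (s * v 0))] = theta τ p v := by
      intro v
      simp [theta, motionFun]
      linear_combination τ * (p 1 * v 0 - p 0 * v 1) * hs
    rw [ht, ht]
    simp
    linear_combination (v 0 * w 0 - δ * v 1 * w 1) * hs

/-! ### Parametrizations -/

section Parametrizations

variable {M : Type*} [TopologicalSpace M] [ChartedSpace (Fin 2 → ℝ) M]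

/-- The differential of a parametrized surface. -/
theorem exists_diff_eq {τ δ : ℝ} {F : M → Fin 3 → ℝ} {P : (Fin 2 → ℝ) → Fin 3 → ℝ}
    (hF : ContMDiff 𝓘(ℝ, Fin 2 → ℝ) 𝓘(ℝ, Fin 3 → ℝ) ∞ F) (hP : Differentiable ℝ P)
    (h : IsParametrizedBy τ δ F P) (p : M) :
    ∃ (w : Fin 2 → ℝ) (A : (Fin 2 → ℝ) ≃L[ℝ] TangentSpace 𝓘(ℝ, Fin 2 → ℝ) p),
      ∀ X, ip τ δ (F p) (diff F p (A X)) (diff F p (A X))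
        = ip τ δ (P w) (diff P w X) (diff P w X) := by
  obtain ⟨Φ, hΦ, hloc⟩ := h
  obtain ⟨e, he, hpe, heq⟩ := hloc p
  obtain ⟨w, hw, rfl⟩ : ∃ w ∈ e.target, e.symm w = p :=
    ⟨e p, e.map_source hpe, e.left_inv hpe⟩
  obtain ⟨A, hA⟩ := exists_tangent_equiv he hw
  refine ⟨w, A, fun X => ?_⟩
  have hFP : ∀ x ∈ e.target, F (e.symm x) = Φ (P x) := fun x hx => by
    rw [heq _ (e.map_target hx), e.right_inv hx]
  have hder : fderiv ℝ (F ∘ e.symm) w = (fderiv ℝ Φ (P w)).comp (fderiv ℝ P w) := by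
    rw [← fderiv_comp w (hΦ.smooth.differentiable (by simp) _) (hP w)]
    apply Filter.EventuallyEq.fderiv_eq
    filter_upwards [e.open_target.mem_nhds hw] with x hx using hFP x hx
  rw [← hA F hF, hder, hFP w hw, diff_eq_fderiv]
  exact hΦ.preserves _ _ _

theorem IsTimelike.of_isParametrizedBy {τ δ : ℝ} {F : M → Fin 3 → ℝ}
    {P : (Fin 2 → ℝ) → Fin 3 → ℝ} (hP' : IsTimelike τ δ P)
    (hF : ContMDiff 𝓘(ℝ, Fin 2 → ℝ) 𝓘(ℝ, Fin 3 → ℝ) ∞ F) (hP : Differentiable ℝ P)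
    (h : IsParametrizedBy τ δ F P) : IsTimelike τ δ F := by
  intro p
  obtain ⟨w, A, hA⟩ := exists_diff_eq hF hP h p
  obtain ⟨⟨X, hX⟩, Y, hY⟩ := hP' w
  exact ⟨⟨A X, (hA X).trans_lt hX⟩, A Y, hY.trans_eq (hA Y).symm⟩

theorem IsSpacelike.of_isParametrizedBy {τ δ : ℝ} {F : M → Fin 3 → ℝ}
    {P : (Fin 2 → ℝ) → Fin 3 → ℝ} (hP' : IsSpacelike τ δ P)
    (hF : ContMDiff 𝓘(ℝ, Fin 2 → ℝ) 𝓘(ℝ, Fin 3 → ℝ) ∞ F) (hP : Differentiable ℝ P)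
    (h : IsParametrizedBy τ δ F P) : IsSpacelike τ δ F := by
  intro p X hX
  obtain ⟨w, A, hA⟩ := exists_diff_eq hF hP h p
  have := hP' w (A.symm X) (mt A.symm.map_eq_zero_iff.1 hX)
  rwa [← hA, A.apply_symm_apply] at this

variable [IsManifold 𝓘(ℝ, Fin 2 → ℝ) ∞ M]

/-- A smooth map with injective differentials from a surface to the plane is locally a chart. -/
theorem exists_chart_of_injective {h : M → Fin 2 → ℝ} {V : Set M} (hV : IsOpen V) {p : M}
    (hp : p ∈ V) (hh : ContMDiffOn 𝓘(ℝ, Fin 2 → ℝ) 𝓘(ℝ, Fin 2 → ℝ) ∞ h V)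
    (hinj : ∀ q ∈ V, Function.Injective (mfderiv 𝓘(ℝ, Fin 2 → ℝ) 𝓘(ℝ, Fin 2 → ℝ) h q)) :
    ∃ e ∈ IsManifold.maximalAtlas 𝓘(ℝ, Fin 2 → ℝ) ∞ M,
      p ∈ e.source ∧ e.source ⊆ V ∧ ∀ q ∈ e.source, e q = h q := by
  set c := chartAt (Fin 2 → ℝ) p with hc
  have hpc : p ∈ c.source := mem_chart_source _ p
  have hcat : c ∈ IsManifold.maximalAtlas 𝓘(ℝ, Fin 2 → ℝ) ∞ M :=
    IsManifold.chart_mem_maximalAtlas p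
  have hsm : ∀ w ∈ c.target, c.symm w ∈ V → ContDiffAt ℝ ∞ (h ∘ c.symm) w := by
    intro w hw hwV
    rw [← contMDiffAt_iff_contDiffAt]
    exact ContMDiffAt.comp w (hh.contMDiffAt (hV.mem_nhds hwV))
      (contMDiffAt_symm_of_mem_maximalAtlas hcat hw)
  have hder : ∀ w ∈ c.target, c.symm w ∈ V → ∃ B : (Fin 2 → ℝ) ≃L[ℝ] (Fin 2 → ℝ),
      HasFDerivAt (h ∘ c.symm) (B : (Fin 2 → ℝ) →L[ℝ] (Fin 2 → ℝ)) w := by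
    intro w hw hwV
    have hi : Function.Injective (fderiv ℝ (h ∘ c.symm) w) := by
      intro X Y hXY
      have hd : MDifferentiableAt 𝓘(ℝ, Fin 2 → ℝ) 𝓘(ℝ, Fin 2 → ℝ) h (c.symm w) :=
        (hh.contMDiffAt (hV.mem_nhds hwV)).mdifferentiableAt (by simp)
      rw [fderiv_comp_symm hcat hw hd, fderiv_comp_symm hcat hw hd] at hXY
      exact (tangentEquiv hcat hw).injective (hinj _ hwV hXY)
    refine ⟨(LinearEquiv.ofInjectiveEndo (fderiv ℝ (h ∘ c.symm) w).toLinearMap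
      hi).toContinuousLinearEquiv, ?_⟩
    exact ((hsm w hw hwV).differentiableAt (by simp)).hasFDerivAt.congr_fderiv (by ext; rfl)
  have hcp : c p ∈ c.target := c.map_source hpc
  have hcpV : c.symm (c p) ∈ V := by rwa [c.left_inv hpc]
  obtain ⟨B, hB⟩ := hder (c p) hcp hcpV
  set φ := (hsm (c p) hcp hcpV).toOpenPartialHomeomorph (h ∘ c.symm) hB (by simp) with hφ
  have hφc : (φ : (Fin 2 → ℝ) → Fin 2 → ℝ) = h ∘ c.symm := rfl
  have hφp : c p ∈ φ.source :=
    (hsm (c p) hcp hcpV).mem_toOpenPartialHomeomorph_source hB (by simp)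
  -- Restricting to `V` keeps the derivative of `h` invertible at every point of the source, not
  -- only at `p`, which is what makes the inverse smooth on the whole target.
  set e := (c.trans φ).restrOpen V hV with he
  have hes : ∀ q, q ∈ e.source ↔ (q ∈ c.source ∧ c q ∈ φ.source) ∧ q ∈ V := by
    intro q
    simp [he]
  have heq : ∀ q ∈ e.source, e q = h q := by
    intro q hq
    change h (c.symm (c q)) = h q
    rw [c.left_inv ((hes q).1 hq).1.1]
  refine ⟨e, ?_, (hes p).2 ⟨⟨hpc, hφp⟩, hp⟩, fun q hq => ((hes q).1 hq).2, heq⟩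
  apply OpenPartialHomeomorph.mem_maximalAtlas_of_contMDiffOn
  · exact (hh.mono fun q hq => ((hes q).1 hq).2).congr heq
  · intro y hy
    have hq := (hes _).1 (e.map_target hy)
    have hy' : y ∈ φ.target := by
      have : y ∈ (c.trans φ).target := by
        rw [← (c.trans φ).image_source_eq_target]
        refine ⟨e.symm y, by simpa using hq.1, ?_⟩
        exact e.right_inv hy
      exact ((OpenPartialHomeomorph.trans_target _ _).subset this).1
    have hw : φ.symm y ∈ c.target := by
      have : c (e.symm y) = φ.symm y := by
        have h1 : φ (c (e.symm y)) = y := e.right_inv hy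
        have h2 := φ.left_inv hq.1.2
        rw [h1] at h2
        exact h2.symm
      rw [← this]
      exact c.map_source hq.1.1
    have hwV : c.symm (φ.symm y) ∈ V := hq.2
    obtain ⟨B', hB'⟩ := hder _ hw hwV
    have h1 : ContDiffAt ℝ ∞ φ.symm y := φ.contDiffAt_symm hy' hB' (hsm _ hw hwV)
    have h2 : ContMDiffAt 𝓘(ℝ, Fin 2 → ℝ) 𝓘(ℝ, Fin 2 → ℝ) ∞ (c.symm ∘ φ.symm) y :=
      ContMDiffAt.comp y (contMDiffAt_symm_of_mem_maximalAtlas hcat hw) h1.contMDiffAt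
    exact h2.contMDiffWithinAt

/-- An immersed surface that factors locally through a parametrized surface is parametrized by
it. -/
theorem isParametrizedBy_of_local {τ δ : ℝ} {F : M → Fin 3 → ℝ} {P : (Fin 2 → ℝ) → Fin 3 → ℝ}
    (hF : ∀ p, Function.Injective (diff F p)) (hP : Differentiable ℝ P)
    {Φ : (Fin 3 → ℝ) ≃ (Fin 3 → ℝ)} (hΦ : IsAmbientIsometry τ δ Φ)
    (hloc : ∀ p, ∃ (h : M → Fin 2 → ℝ) (V : Set M), IsOpen V ∧ p ∈ V ∧
      ContMDiffOn 𝓘(ℝ, Fin 2 → ℝ) 𝓘(ℝ, Fin 2 → ℝ) ∞ h V ∧ ∀ q ∈ V, F q = Φ (P (h q))) :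
    IsParametrizedBy τ δ F P := by
  refine ⟨Φ, hΦ, fun p => ?_⟩
  obtain ⟨h, V, hV, hp, hh, hFV⟩ := hloc p
  -- The differential of F factors through that of `h`, so injectivity of the former gives
  -- injectivity of the latter.
  obtain ⟨e, he, hpe, hes, heq⟩ := exists_chart_of_injective hV hp hh fun q hq X Y hXY => by
    apply hF q
    have hd : MDifferentiableAt 𝓘(ℝ, Fin 2 → ℝ) 𝓘(ℝ, Fin 2 → ℝ) h q :=
      (hh.contMDiffAt (hV.mem_nhds hq)).mdifferentiableAt (by simp)
    have hd2 : MDifferentiableAt 𝓘(ℝ, Fin 2 → ℝ) 𝓘(ℝ, Fin 3 → ℝ) (Φ ∘ P) (h q) :=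
      ((hΦ.smooth.differentiable (by simp)).comp hP (h q)).mdifferentiableAt
    have hc : diff F q = mfderiv 𝓘(ℝ, Fin 2 → ℝ) 𝓘(ℝ, Fin 3 → ℝ) ((Φ ∘ P) ∘ h) q := by
      apply Filter.EventuallyEq.mfderiv_eq
      filter_upwards [hV.mem_nhds hq] with r hr using hFV r hr
    rw [hc, mfderiv_comp q hd2 hd]
    exact congrArg (mfderiv 𝓘(ℝ, Fin 2 → ℝ) 𝓘(ℝ, Fin 3 → ℝ) (Φ ∘ P) (h q)) hXY
  exact ⟨e, he, hpe, fun q hq => by rw [hFV q (hes hq), heq q hq]⟩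

end Parametrizations

/-! ### Flatness of metrics pulled back from constant ones -/

section Flat

/-- The Jacobian matrix. -/
def jacobian (h : (Fin 2 → ℝ) → Fin 2 → ℝ) (x : Fin 2 → ℝ) : Matrix (Fin 2) (Fin 2) ℝ :=
  Matrix.of fun a i => partialD i (fun y => h y a) x

theorem jacobian_mulVec {h : (Fin 2 → ℝ) → Fin 2 → ℝ} {x : Fin 2 → ℝ}
    (hh : DifferentiableAt ℝ h x) (v : Fin 2 → ℝ) : jacobian h x *ᵥ v = fderiv ℝ h x v := by
  ext a
  have : fderiv ℝ h x v a = fderiv ℝ (fun y => h y a) x v := by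
    rw [fderiv_apply hh]; rfl
  rw [this, fderiv_apply_eq_sum]
  simp [Matrix.mulVec, dotProduct, jacobian, mul_comm]

variable {U : Set (Fin 2 → ℝ)} {h : (Fin 2 → ℝ) → Fin 2 → ℝ}
  {g : (Fin 2 → ℝ) → Matrix (Fin 2) (Fin 2) ℝ} {Q : Matrix (Fin 2) (Fin 2) ℝ} {x : Fin 2 → ℝ}

theorem jacobian_contDiffAt (hU : IsOpen U) (hh : ContDiffOn ℝ ∞ h U) (hx : x ∈ U)
    (a i : Fin 2) : ContDiffAt ℝ ∞ (fun y => jacobian h y a i) x :=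
  contDiffAt_partialD i (contDiffAt_pi.1 (hh.contDiffAt (hU.mem_nhds hx)) a)

theorem partialD_jacobian_comm (hU : IsOpen U) (hh : ContDiffOn ℝ ∞ h U) (hx : x ∈ U)
    (a i j : Fin 2) : partialD i (fun y => jacobian h y a j) x
      = partialD j (fun y => jacobian h y a i) x :=
  partialD_comm i j (contDiffAt_pi.1 (hh.contDiffAt (hU.mem_nhds hx)) a)

/-- The Christoffel symbols of a pulled back constant metric. -/
theorem sum_jacobian_mul_christoffel (hU : IsOpen U) (hh : ContDiffOn ℝ ∞ h U) (hQ : Qᵀ = Q)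
    (hg : ∀ y ∈ U, g y = (jacobian h y)ᵀ * Q * jacobian h y)
    (hQd : IsUnit Q.det) (hJ : ∀ y ∈ U, IsUnit (jacobian h y).det) (hx : x ∈ U) (a i j : Fin 2) :
    ∑ k, jacobian h x a k * christoffel g k i j x = partialD i (fun y => jacobian h y a j) x := by
  set J := jacobian h with hJdef
  have hd : ∀ a i, DifferentiableAt ℝ (fun y => J y a i) x := fun a i =>
    (jacobian_contDiffAt hU hh hx a i).differentiableAt (by simp)
  have hsymm : ∀ a b, Q a b = Q b a := fun a b => congrFun (congrFun hQ b) a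
  have hgd : ∀ i j l, partialD i (fun y => g y j l) x
      = ∑ b, ∑ a, (partialD i (fun y => J y a j) x * Q a b * J x b l
        + J x a j * Q a b * partialD i (fun y => J y b l) x) := by
    intro i j l
    rw [partialD_congr i (g := fun y => ∑ b, ∑ a, J y a j * Q a b * J y b l)]
    · rw [partialD_sum]
      · refine Finset.sum_congr rfl fun b _ => ?_
        rw [partialD_sum]
        · refine Finset.sum_congr rfl fun a _ => ?_
          have h1 := hd a j
          have h2 := hd b l
          simp (disch := fun_prop) only [partialD_mul, partialD_const]
          ring
        · intro a _
          have h1 := hd a j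
          have h2 := hd b l
          fun_prop
      · intro b _
        have h2 := hd b l
        have h1 := fun a => hd a j
        fun_prop
    · filter_upwards [hU.mem_nhds hx] with y hy
      rw [hg y hy]
      simp only [Matrix.mul_apply, Matrix.transpose_apply, Finset.sum_mul]
  -- Of the six terms produced by the product rule, symmetry of the second derivatives of `h`
  -- cancels four and makes the other two equal.
  have hbr : ∀ l, partialD i (fun y => g y j l) x + partialD j (fun y => g y i l) x
      - partialD l (fun y => g y i j) x
      = 2 * ((J x)ᵀ * Q) l ⬝ᵥ fun a => partialD i (fun y => J y a j) x := by
    intro l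
    have c1 := fun a => partialD_jacobian_comm hU hh hx a j i
    have c2 := fun a => partialD_jacobian_comm hU hh hx a l i
    have c3 := fun a => partialD_jacobian_comm hU hh hx a l j
    rw [← hJdef] at c1 c2 c3
    simp only [hgd, c1, c2, c3, dotProduct, Matrix.mul_apply, Matrix.transpose_apply,
      Fin.sum_univ_two]
    rw [hsymm 1 0]
    ring
  have hinv : J x * ((g x)⁻¹ * ((J x)ᵀ * Q)) = 1 := by
    rw [mul_eq_one_comm, Matrix.mul_assoc, ← hg x hx]
    apply Matrix.nonsing_inv_mul
    rw [hg x hx, Matrix.det_mul, Matrix.det_mul, Matrix.det_transpose]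
    exact ((hJ x hx).mul hQd).mul (hJ x hx)
  have hΓ : (fun k => christoffel g k i j x)
      = ((g x)⁻¹ * ((J x)ᵀ * Q)) *ᵥ fun a => partialD i (fun y => J y a j) x := by
    ext k
    rw [← Matrix.mulVec_mulVec]
    simp only [christoffel, hbr, Matrix.mulVec, dotProduct, Fin.sum_univ_two]
    ring
  have := congrArg (fun v => (J x *ᵥ v) a) hΓ
  simp only [Matrix.mulVec_mulVec, hinv, Matrix.one_mulVec] at this
  exact this

/-- Cramer's rule solves the linear system of `sum_jacobian_mul_christoffel`, giving the symbols as
quotients of smooth functions. This justifies the product rule in `riemann_eq_zero`. -/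
theorem differentiableAt_christoffel (hU : IsOpen U) (hh : ContDiffOn ℝ ∞ h U) (hQ : Qᵀ = Q)
    (hg : ∀ y ∈ U, g y = (jacobian h y)ᵀ * Q * jacobian h y)
    (hQd : IsUnit Q.det) (hJ : ∀ y ∈ U, IsUnit (jacobian h y).det) (hx : x ∈ U) (k i j : Fin 2) :
    DifferentiableAt ℝ (christoffel g k i j) x := by
  have hd : ∀ a i, DifferentiableAt ℝ (fun y => jacobian h y a i) x := fun a i =>
    (jacobian_contDiffAt hU hh hx a i).differentiableAt (by simp)
  have hd2 : ∀ a, DifferentiableAt ℝ (partialD i (fun y => jacobian h y a j)) x := fun a =>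
    (contDiffAt_partialD i (jacobian_contDiffAt hU hh hx a j)).differentiableAt (by simp)
  have heq : christoffel g k i j =ᶠ[𝓝 x] fun y => (jacobian h y 0 0 * jacobian h y 1 1
      - jacobian h y 0 1 * jacobian h y 1 0)⁻¹ *
        ∑ a, (jacobian h y).adjugate k a * partialD i (fun y => jacobian h y a j) y := by
    filter_upwards [hU.mem_nhds hx] with y hy
    have hsum : jacobian h y *ᵥ (fun k => christoffel g k i j y)
        = fun a => partialD i (fun y => jacobian h y a j) y :=
      funext fun a => sum_jacobian_mul_christoffel hU hh hQ hg hQd hJ hy a i j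
    have h2 := congrArg (fun v => ((jacobian h y).adjugate *ᵥ v) k) hsum
    simp only [Matrix.mulVec_mulVec, Matrix.adjugate_mul, Matrix.smul_mulVec, Matrix.one_mulVec,
      Pi.smul_apply, smul_eq_mul] at h2
    rw [← Matrix.det_fin_two]
    rw [eq_inv_mul_iff_mul_eq₀ (hJ y hy).ne_zero]
    exact h2
  refine DifferentiableAt.congr_of_eventuallyEq ?_ heq
  have hdet : jacobian h x 0 0 * jacobian h x 1 1 - jacobian h x 0 1 * jacobian h x 1 0 ≠ 0 := by
    rw [← Matrix.det_fin_two]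
    exact (hJ x hx).ne_zero
  have h00 := hd 0 0
  have h01 := hd 0 1
  have h10 := hd 1 0
  have h11 := hd 1 1
  have hadj : ∀ k a, DifferentiableAt ℝ (fun y => (jacobian h y).adjugate k a) x := by
    simp only [Matrix.adjugate_fin_two, Fin.forall_fin_two]
    simp
    exact ⟨⟨h11, h01⟩, h10, h00⟩
  refine DifferentiableAt.mul (DifferentiableAt.inv (by fun_prop) hdet) ?_
  exact DifferentiableAt.fun_sum fun a _ => (hadj k a).mul (hd2 a)

/-- A metric pulled back from a constant metric is flat. -/
theorem riemann_eq_zero (hU : IsOpen U) (hh : ContDiffOn ℝ ∞ h U) (hQ : Qᵀ = Q)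
    (hg : ∀ y ∈ U, g y = (jacobian h y)ᵀ * Q * jacobian h y)
    (hQd : IsUnit Q.det) (hJ : ∀ y ∈ U, IsUnit (jacobian h y).det) (hx : x ∈ U)
    (l k i j : Fin 2) : riemann g l k i j x = 0 := by
  have hS := fun y (hy : y ∈ U) => sum_jacobian_mul_christoffel hU hh hQ hg hQd hJ hy
  have hΓ := differentiableAt_christoffel hU hh hQ hg hQd hJ hx
  have hd : ∀ a i, DifferentiableAt ℝ (fun y => jacobian h y a i) x := fun a i =>
    (jacobian_contDiffAt hU hh hx a i).differentiableAt (by simp)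
  have hder : ∀ m a i j, ∑ k, (partialD m (fun y => jacobian h y a k) x * christoffel g k i j x
      + jacobian h x a k * partialD m (christoffel g k i j) x)
      = partialD m (partialD i (fun y => jacobian h y a j)) x := by
    intro m a i j
    rw [← partialD_congr m (f := fun y => ∑ k, jacobian h y a k * christoffel g k i j y)]
    · rw [partialD_sum]
      · exact Finset.sum_congr rfl fun k _ => (partialD_mul m (hd a k) (hΓ k i j)).symm
      · exact fun k _ => (hd a k).mul (hΓ k i j)
    · filter_upwards [hU.mem_nhds hx] with y hy using hS y hy a i j
  -- Differentiating JΓᵢⱼ = ∂ᵢJⱼ and antisymmetrizing, the third derivatives of `h` cancel and what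
  -- is left is J applied to the curvature.
  have hzero : jacobian h x *ᵥ (fun l => riemann g l k i j x) = 0 := by
    ext a
    have e1 := hder i a j k
    have e2 := hder j a i k
    have e3 := partialD_comm i j (jacobian_contDiffAt hU hh hx a k)
    have s1 := fun m => hS x hx a i m
    have s2 := fun m => hS x hx a j m
    simp only [← s1, ← s2, Fin.sum_univ_two] at e1 e2
    simp only [Matrix.mulVec, dotProduct, riemann, Fin.sum_univ_two, Pi.zero_apply]
    linear_combination e1 - e2 + e3
  have := (Matrix.mulVec_injective_iff_isUnit.2 ((Matrix.isUnit_iff_isUnit_det _).2 (hJ x hx)))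
    (hzero.trans (Matrix.mulVec_zero _).symm)
  exact congrFun this l

theorem ip_comm (τ δ : ℝ) (p v w : Fin 3 → ℝ) : ip τ δ p v w = ip τ δ p w v := by
  rw [ip_eq, ip_eq]; ring

theorem ip_comb (τ δ : ℝ) (p u v : Fin 3 → ℝ) (a b c d : ℝ) :
    ip τ δ p (a • u + b • v) (c • u + d • v) =
      a * ip τ δ p u u * c + b * ip τ δ p v u * c + (a * ip τ δ p u v * d + b * ip τ δ p v v * d)
      := by
  simp only [ip_eq, theta, Pi.add_apply, Pi.smul_apply, smul_eq_mul]; ring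

/-- A surface parametrized by a map with constant first fundamental form is flat. -/
theorem IsFlat.of_isParametrizedBy {M : Type*} [TopologicalSpace M]
    [ChartedSpace (Fin 2 → ℝ) M] [IsManifold 𝓘(ℝ, Fin 2 → ℝ) ∞ M] {τ δ : ℝ} {F : M → Fin 3 → ℝ}
    {P : (Fin 2 → ℝ) → Fin 3 → ℝ} (hP : Differentiable ℝ P)
    (h : IsParametrizedBy τ δ F P) (hPQ : ∀ w, firstForm τ δ P w = Q) (hQd : Q.det ≠ 0) :
    IsFlat τ δ F := by
  intro p
  obtain ⟨Φ, hΦ, hloc⟩ := h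
  obtain ⟨e, he, hpe, heq⟩ := hloc p
  set c := chartAt (Fin 2 → ℝ) p with hc
  have hpc : p ∈ c.source := mem_chart_source _ p
  have hcat : c ∈ IsManifold.maximalAtlas 𝓘(ℝ, Fin 2 → ℝ) ∞ M :=
    IsManifold.chart_mem_maximalAtlas p
  set U := c.target ∩ c.symm ⁻¹' e.source with hUdef
  have hU : IsOpen U := c.isOpen_inter_preimage_symm e.open_source
  -- Curvature is computed in the preferred chart `c`, while the constant metric appears in the
  -- chart `e`; the transition map is the map to pull back along.
  set k := e ∘ c.symm with hk
  have hsm : ContDiffOn ℝ ∞ k U := by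
    rw [← contMDiffOn_iff_contDiffOn]
    exact (contMDiffOn_of_mem_maximalAtlas he).comp
      ((contMDiffOn_symm_of_mem_maximalAtlas hcat).mono Set.inter_subset_left) fun w hw => hw.2
  have hkd : ∀ w ∈ U, DifferentiableAt ℝ k w := fun w hw =>
    (hsm.contDiffAt (hU.mem_nhds hw)).differentiableAt (by simp)
  have hJ : ∀ w ∈ U, IsUnit (jacobian k w).det := by
    intro w hw
    rw [← Matrix.isUnit_iff_isUnit_det, ← Matrix.mulVec_injective_iff_isUnit]
    intro X Y hXY
    rw [jacobian_mulVec (hkd w hw), jacobian_mulVec (hkd w hw)] at hXY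
    have hm := (mdifferentiable_symm_of_mem_maximalAtlas he).symm
    have hd := hm.mdifferentiableAt hw.2
    rw [OpenPartialHomeomorph.symm_symm] at hd
    rw [hk, fderiv_comp_symm hcat hw.1 hd, fderiv_comp_symm hcat hw.1 hd] at hXY
    exact (tangentEquiv hcat hw.1).injective (hm.mfderiv_injective hw.2 hXY)
  have hQ : Qᵀ = Q := by
    rw [← hPQ 0]
    ext i j
    exact ip_comm _ _ _ _ _
  have hg : ∀ w ∈ U, firstForm τ δ (F ∘ c.symm) w = (jacobian k w)ᵀ * Q * jacobian k w := by
    intro w hw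
    have hder : fderiv ℝ (F ∘ c.symm) w
        = (fderiv ℝ Φ (P (k w))).comp ((fderiv ℝ P (k w)).comp (fderiv ℝ k w)) := by
      rw [← fderiv_comp w (hP _) (hkd w hw)]
      refine Eq.trans ?_ (fderiv_comp w (g := Φ) (f := P ∘ k)
        (hΦ.smooth.differentiable (by simp) _) ((hP _).comp w (hkd w hw)))
      apply Filter.EventuallyEq.fderiv_eq
      filter_upwards [hU.mem_nhds hw] with y hy using heq _ hy.2
    have hcol : ∀ i, fderiv ℝ P (k w) (fderiv ℝ k w (Pi.single i 1))
        = jacobian k w 0 i • fderiv ℝ P (k w) (Pi.single 0 1)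
          + jacobian k w 1 i • fderiv ℝ P (k w) (Pi.single 1 1) := by
      intro i
      rw [LocalHelix.fderiv_eq, ← jacobian_mulVec (hkd w hw)]
      simp
    ext i j
    change ip τ δ ((F ∘ c.symm) w) _ _ = _
    have hFw : (F ∘ c.symm) w = Φ (P (k w)) := heq _ hw.2
    rw [hder, hFw]
    simp only [ContinuousLinearMap.comp_apply]
    rw [hΦ.preserves, hcol, hcol, ip_comb, ← hPQ (k w)]
    simp only [Matrix.mul_apply, Fin.sum_univ_two, Matrix.transpose_apply, firstForm,
      Matrix.of_apply]
    ring
  have hcp : c p ∈ U := ⟨c.map_source hpc, by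
    change c.symm (c p) ∈ e.source
    rwa [c.left_inv hpc]⟩
  have hR := riemann_eq_zero hU hsm hQ hg hQd.isUnit hJ hcp
  simp [gaussCurvature, planeCurvature, ← hc, hR]

end Flat

/-! ### Vertical cylinders over plane curves -/

theorem diff_restrict {Ω : TopologicalSpace.Opens (Fin 2 → ℝ)} {P : (Fin 2 → ℝ) → Fin 3 → ℝ}
    (hP : ContDiff ℝ ∞ P) (w : Ω) : diff (restrict Ω P) w = fderiv ℝ P w := by
  have hs : ContMDiff 𝓘(ℝ, Fin 2 → ℝ) 𝓘(ℝ, Fin 3 → ℝ) ∞ (restrict Ω P) :=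
    hP.contMDiff.comp contMDiff_subtype_val
  rw [diff, ((hs w).mdifferentiableAt (by simp)).mfderiv]
  have h1 := TopologicalSpace.Opens.chartAt_subtype_val_symm_eventuallyEq (H := Fin 2 → ℝ) Ω (x := w)
  have h2 : extChartAt 𝓘(ℝ, Fin 2 → ℝ) w w = (w : Fin 2 → ℝ) := rfl
  have h3 : writtenInExtChartAt 𝓘(ℝ, Fin 2 → ℝ) 𝓘(ℝ, Fin 3 → ℝ) w (restrict Ω P)
      =ᶠ[𝓝 (w : Fin 2 → ℝ)] P := by
    filter_upwards [h1] with y hy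
    exact (congrArg P hy).symm
  rw [h2]
  simp only [ModelWithCorners.range_eq_univ, fderivWithin_univ]
  exact h3.fderiv_eq

/-- The vertical cylinder over the plane curve `(ξ, η)`. -/
def vertical (ξ η : ℝ → ℝ) (κ : ℝ) (w : Fin 2 → ℝ) : Fin 3 → ℝ :=
  ![ξ (w 1), η (w 1), w 0 + κ * w 1]

/-- The horizontal lift of the vector field `(a, b)` along the vertical cylinder. -/
def verticalNormal (τ : ℝ) (ξ η a b : ℝ → ℝ) (w : Fin 2 → ℝ) : Fin 3 → ℝ :=
  ![a (w 1), b (w 1), τ * (ξ (w 1) * b (w 1) - η (w 1) * a (w 1))]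

/-- A plane curve of constant speed and constant curvature `2 H` with unit normal `(a, b)`, such
that the vertical cylinder over it has constant coefficients. -/
structure CurveData (τ δ ε ρ H m κ : ℝ) (ξ η a b : ℝ → ℝ) : Prop where
  delta : δ ^ 2 = 1
  sign : ε = 1 ∨ ε = -1
  speed : ρ ≠ 0
  smooth_fst : ContDiff ℝ ∞ ξ
  smooth_snd : ContDiff ℝ ∞ η
  normal_smooth_fst : ContDiff ℝ ∞ a
  normal_smooth_snd : ContDiff ℝ ∞ b
  deriv_fst : ∀ t, HasDerivAt ξ (ρ * (δ * b t)) t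
  deriv_snd : ∀ t, HasDerivAt η (ρ * a t) t
  normal_deriv_fst : ∀ t, HasDerivAt a (-(2 * H) * (ρ * (δ * b t))) t
  normal_deriv_snd : ∀ t, HasDerivAt b (-(2 * H) * (ρ * a t)) t
  unit : ∀ t, a t ^ 2 - δ * b t ^ 2 = ε
  -- The left side is the contact form on ∂ᵥ; its constancy makes the induced metric constant.
  moment : ∀ t, κ + τ * (η t * (ρ * (δ * b t)) - ξ t * (ρ * a t)) = m

theorem hasFDerivAt_comp_snd {f : ℝ → ℝ} {f' : ℝ} {w : Fin 2 → ℝ} (hf : HasDerivAt f f' (w 1)) :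
    HasFDerivAt (fun y : Fin 2 → ℝ => f (y 1))
      (f' • ContinuousLinearMap.proj (R := ℝ) (φ := fun _ : Fin 2 => ℝ) 1) w :=
  hf.comp_hasFDerivAt w (hasFDerivAt_coord 1 w)

namespace CurveData

variable {τ δ ε ρ H m κ : ℝ} {ξ η a b : ℝ → ℝ}

theorem contDiff (h : CurveData τ δ ε ρ H m κ ξ η a b) : ContDiff ℝ ∞ (vertical ξ η κ) := by
  have h1 := h.smooth_fst
  have h2 := h.smooth_snd
  rw [contDiff_pi]
  simp only [Fin.forall_fin_succ, vertical]
  refine ⟨?_, ?_, ?_, fun i => i.elim0⟩ <;> simp <;> fun_prop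

theorem contDiff_normal (h : CurveData τ δ ε ρ H m κ ξ η a b) :
    ContDiff ℝ ∞ (verticalNormal τ ξ η a b) := by
  have h1 := h.smooth_fst
  have h2 := h.smooth_snd
  have h3 := h.normal_smooth_fst
  have h4 := h.normal_smooth_snd
  rw [contDiff_pi]
  simp only [Fin.forall_fin_succ, verticalNormal]
  refine ⟨?_, ?_, ?_, fun i => i.elim0⟩ <;> simp <;> fun_prop

theorem fderiv_vertical (h : CurveData τ δ ε ρ H m κ ξ η a b) (w X : Fin 2 → ℝ) :
    fderiv ℝ (vertical ξ η κ) w X =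
      ![ρ * (δ * b (w 1)) * X 1, ρ * a (w 1) * X 1, X 0 + κ * X 1] := by
  have hd := (h.contDiff.differentiable (by simp)) w
  ext j
  have : fderiv ℝ (vertical ξ η κ) w X j = fderiv ℝ (fun q => vertical ξ η κ q j) w X := by
    rw [fderiv_apply hd]; rfl
  rw [this]
  clear this
  revert j
  simp only [Fin.forall_fin_succ]
  refine ⟨?_, ?_, ?_, fun i => i.elim0⟩
  · change fderiv ℝ (fun q : Fin 2 → ℝ => ξ (q 1)) w X = _
    rw [(hasFDerivAt_comp_snd (h.deriv_fst (w 1))).fderiv]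
    simp
  · change fderiv ℝ (fun q : Fin 2 → ℝ => η (q 1)) w X = _
    rw [(hasFDerivAt_comp_snd (h.deriv_snd (w 1))).fderiv]
    simp
  · change fderiv ℝ (fun q : Fin 2 → ℝ => q 0 + κ * q 1) w X = _
    rw [((hasFDerivAt_coord 0 w).fun_add ((hasFDerivAt_coord 1 w).const_mul κ)).fderiv]
    simp

theorem fderiv_verticalNormal (h : CurveData τ δ ε ρ H m κ ξ η a b) (w X : Fin 2 → ℝ) :
    fderiv ℝ (verticalNormal τ ξ η a b) w X =
      ![-(2 * H) * (ρ * (δ * b (w 1))) * X 1, -(2 * H) * (ρ * a (w 1)) * X 1,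
        τ * ((ρ * (δ * b (w 1))) * b (w 1) + ξ (w 1) * (-(2 * H) * (ρ * a (w 1)))
          - (ρ * a (w 1) * a (w 1) + η (w 1) * (-(2 * H) * (ρ * (δ * b (w 1)))))) * X 1] := by
  have hd := (h.contDiff_normal.differentiable (by simp)) w
  ext j
  have : fderiv ℝ (verticalNormal τ ξ η a b) w X j
      = fderiv ℝ (fun q => verticalNormal τ ξ η a b q j) w X := by
    rw [fderiv_apply hd]; rfl
  rw [this]
  clear this
  revert j
  simp only [Fin.forall_fin_succ]
  refine ⟨?_, ?_, ?_, fun i => i.elim0⟩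
  · change fderiv ℝ (fun q : Fin 2 → ℝ => a (q 1)) w X = _
    rw [(hasFDerivAt_comp_snd (h.normal_deriv_fst (w 1))).fderiv]
    simp
  · change fderiv ℝ (fun q : Fin 2 → ℝ => b (q 1)) w X = _
    rw [(hasFDerivAt_comp_snd (h.normal_deriv_snd (w 1))).fderiv]
    simp
  · change fderiv ℝ (fun q : Fin 2 → ℝ => τ * (ξ (q 1) * b (q 1) - η (q 1) * a (q 1))) w X = _
    rw [(hasFDerivAt_comp_snd (((((h.deriv_fst (w 1)).fun_mul (h.normal_deriv_snd (w 1))).fun_sub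
      ((h.deriv_snd (w 1)).fun_mul (h.normal_deriv_fst (w 1)))).const_mul τ))).fderiv]
    simp

theorem theta_fderiv (h : CurveData τ δ ε ρ H m κ ξ η a b) (w X : Fin 2 → ℝ) :
    theta τ (vertical ξ η κ w) (fderiv ℝ (vertical ξ η κ) w X) = X 0 + m * X 1 := by
  rw [h.fderiv_vertical, ← h.moment (w 1)]
  simp [theta, vertical]
  ring

theorem theta_normal (w : Fin 2 → ℝ) :
    theta τ (vertical ξ η κ w) (verticalNormal τ ξ η a b w) = 0 := by
  simp [theta, vertical, verticalNormal]
  ring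

/-- The metric of the vertical cylinder. -/
theorem ip_fderiv (h : CurveData τ δ ε ρ H m κ ξ η a b) (w X Y : Fin 2 → ℝ) :
    ip τ δ (vertical ξ η κ w) (fderiv ℝ (vertical ξ η κ) w X) (fderiv ℝ (vertical ξ η κ) w Y)
      = δ * ((X 0 + m * X 1) * (Y 0 + m * Y 1)) - δ * ε * ρ ^ 2 * (X 1 * Y 1) := by
  rw [ip_eq, h.theta_fderiv, h.theta_fderiv, h.fderiv_vertical, h.fderiv_vertical]
  simp only [Matrix.cons_val]
  rw [← h.unit (w 1)]
  ring

theorem firstForm_eq (h : CurveData τ δ ε ρ H m κ ξ η a b) (w : Fin 2 → ℝ) :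
    firstForm τ δ (vertical ξ η κ) w
      = !![δ, δ * m; δ * m, δ * m ^ 2 - δ * ε * ρ ^ 2] := by
  ext i j
  simp only [firstForm, Matrix.of_apply, h.ip_fderiv]
  revert i j
  simp only [Fin.forall_fin_two]
  refine ⟨⟨?_, ?_⟩, ?_, ?_⟩ <;> simp
  exact Or.inl (by ring)

theorem det_ne_zero (h : CurveData τ δ ε ρ H m κ ξ η a b) :
    (!![δ, δ * m; δ * m, δ * m ^ 2 - δ * ε * ρ ^ 2] : Matrix (Fin 2) (Fin 2) ℝ).det ≠ 0 := by
  have hε : ε ≠ 0 := by rcases h.sign with h | h <;> rw [h] <;> norm_num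
  rw [Matrix.det_fin_two_of]
  have : δ * (δ * m ^ 2 - δ * ε * ρ ^ 2) - δ * m * (δ * m) = -(ε * ρ ^ 2) := by
    linear_combination (-ε * ρ ^ 2) * h.delta
  rw [this]
  exact neg_ne_zero.2 (mul_ne_zero hε (pow_ne_zero 2 h.speed))

theorem injective (h : CurveData τ δ ε ρ H m κ ξ η a b) (w : Fin 2 → ℝ) :
    Function.Injective (fderiv ℝ (vertical ξ η κ) w) := by
  rw [injective_iff_map_eq_zero]
  intro X hX
  have h1 := h.ip_fderiv w X X
  have h2 := h.theta_fderiv w X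
  rw [hX] at h1 h2
  have hδ : δ ≠ 0 := by
    have := h.delta
    rintro rfl; norm_num at this
  have hε : ε ≠ 0 := by rcases h.sign with h | h <;> rw [h] <;> norm_num
  have e1 : X 0 + m * X 1 = 0 := by rw [← h2]; simp [theta]
  rw [e1] at h1
  have e2 : δ * ε * ρ ^ 2 * (X 1 * X 1) = 0 := by
    have : ip τ δ (vertical ξ η κ w) 0 0 = 0 := by simp [ip]
    linarith
  have hρ := h.speed
  have e3 : X 1 = 0 := by simpa [hδ, hε, hρ] using e2
  rw [e3] at e1
  ext i
  fin_cases i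
  · simpa using e1
  · exact e3

theorem isTimelike (h : CurveData τ δ ε ρ H m κ ξ η a b) (hε : ε = 1) (hδ : δ = 1 ∨ δ = -1) :
    IsTimelike τ δ (vertical ξ η κ) := by
  have hρ : 0 < ρ ^ 2 := by have := h.speed; positivity
  have hip : ∀ w X, ip τ δ (vertical ξ η κ w) (diff (vertical ξ η κ) w X)
      (diff (vertical ξ η κ) w X)
      = δ * ((X 0 + m * X 1) * (X 0 + m * X 1)) - δ * ε * ρ ^ 2 * (X 1 * X 1) := by
    intro w X
    rw [diff_eq_fderiv]
    exact h.ip_fderiv w X X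
  intro w
  have h1 := hip w (![-m, 1] : Fin 2 → ℝ)
  have h2 := hip w (![1, 0] : Fin 2 → ℝ)
  simp only [Matrix.cons_val] at h1 h2
  subst hε
  rcases hδ with rfl | rfl
  · exact ⟨⟨_, h1.trans_lt (by nlinarith)⟩, _, (by norm_num : (0 : ℝ) < _).trans_eq h2.symm⟩
  · exact ⟨⟨_, h2.trans_lt (by norm_num)⟩, _, (by nlinarith : (0 : ℝ) < _).trans_eq h1.symm⟩

theorem isSpacelike (h : CurveData τ 1 (-1) ρ H m κ ξ η a b) :
    IsSpacelike τ 1 (vertical ξ η κ) := by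
  suffices hpos : ∀ w X : Fin 2 → ℝ, X ≠ 0 → 0 < ip τ 1 (vertical ξ η κ w)
      (fderiv ℝ (vertical ξ η κ) w X) (fderiv ℝ (vertical ξ η κ) w X) by
    intro w X hX
    rw [diff_eq_fderiv]
    exact hpos w X hX
  intro w X hX
  rw [h.ip_fderiv w X X]
  have hρ : 0 < ρ ^ 2 := by have := h.speed; positivity
  have hX' : X 0 + m * X 1 ≠ 0 ∨ X 1 ≠ 0 := by
    by_contra! hcon
    apply hX
    ext i
    obtain ⟨h0, h1⟩ := hcon
    rw [h1] at h0
    fin_cases i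
    · simpa using h0
    · exact h1
  have h0 := mul_self_nonneg (X 0 + m * X 1)
  have h1 := mul_nonneg hρ.le (mul_self_nonneg (X 1))
  rcases hX' with hX' | hX'
  · have := mul_self_pos.2 hX'
    linarith
  · have := mul_pos hρ (mul_self_pos.2 hX')
    linarith

theorem ip_normal_fderiv (h : CurveData τ δ ε ρ H m κ ξ η a b) (w X : Fin 2 → ℝ) :
    ip τ δ (vertical ξ η κ w) (verticalNormal τ ξ η a b w) (fderiv ℝ (vertical ξ η κ) w X) = 0 := by
  rw [ip_eq, theta_normal, h.fderiv_vertical]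
  simp [verticalNormal]
  ring

theorem isHelixSurface (h : CurveData τ δ ε ρ H m κ ξ η a b)
    (Ω : TopologicalSpace.Opens (Fin 2 → ℝ)) :
    IsHelixSurface τ δ ε 0 (restrict Ω (vertical ξ η κ))
      (restrict Ω (verticalNormal τ ξ η a b)) where
  smooth := h.contDiff.contMDiff.comp contMDiff_subtype_val
  immersion w := by
    rw [diff_restrict h.contDiff]
    exact h.injective w
  normal_smooth := h.contDiff_normal.contMDiff.comp contMDiff_subtype_val
  sign := h.sign
  normal_unit w := by
    have := h.unit ((w : Fin 2 → ℝ) 1)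
    simp only [restrict, ip_eq, theta_normal]
    simp [verticalNormal]
    linarith
  normal_orthogonal w X := by
    rw [diff_restrict h.contDiff]
    exact h.ip_normal_fderiv w X
  angle w := by
    simp only [restrict, ip_eq, theta_normal]
    simp [E3]

/-- The matrix of the shape operator of the vertical cylinder. -/
def shape (τ ε ρ H m : ℝ) : Matrix (Fin 2) (Fin 2) ℝ :=
  !![τ * m / ρ, τ * ρ * ε - (2 * H - τ * m / ρ) * m; -τ / ρ, 2 * H - τ * m / ρ]

/-- With the horizontal vector T = ∂ᵥ − m∂ᵤ, the operator is ∂ᵤ ↦ −(τ/ρ)T, T ↦ τρε ∂ᵤ + 2H T; the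
matrix `shape` is this written in the basis (∂ᵤ, ∂ᵥ). -/
theorem fderiv_shape (h : CurveData τ δ ε ρ H m κ ξ η a b) (w X : Fin 2 → ℝ) :
    fderiv ℝ (vertical ξ η κ) w (Matrix.toLin' (shape τ ε ρ H m) X) =
      -fun k => fderiv ℝ (verticalNormal τ ξ η a b) w X k
        + ∑ i, ∑ j, christoffel (metric τ δ) k i j (vertical ξ η κ w)
          * fderiv ℝ (vertical ξ η κ) w X i * verticalNormal τ ξ η a b w j := by
  have hρ := h.speed
  have hΓ := christoffel_contract τ h.delta (vertical ξ η κ w)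
    (fderiv ℝ (vertical ξ η κ) w X) (verticalNormal τ ξ η a b w)
  have hu := h.unit (w 1)
  have hm := h.moment (w 1)
  have hSX : Matrix.toLin' (shape τ ε ρ H m) X
      = ![τ * m / ρ * X 0 + (τ * ρ * ε - (2 * H - τ * m / ρ) * m) * X 1,
        -τ / ρ * X 0 + (2 * H - τ * m / ρ) * X 1] := by
    ext i
    fin_cases i <;> simp [shape, Matrix.mulVec, dotProduct, Fin.sum_univ_two]
  ext k
  have hΓk := congrFun hΓ k
  rw [Pi.neg_apply, hΓk, h.theta_fderiv, theta_normal, hSX, h.fderiv_vertical, h.fderiv_vertical,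
    h.fderiv_verticalNormal]
  clear hΓk hΓ hSX
  revert k
  simp only [Fin.forall_fin_succ]
  refine ⟨?_, ?_, ?_, fun i => i.elim0⟩
  · simp [verticalNormal]
    field_simp
    ring
  · simp [verticalNormal]
    field_simp
    ring
  · simp [verticalNormal, vertical]
    rw [← hm, ← hu]
    field_simp
    ring

theorem trace_shape :
    (1 / 2) * LinearMap.trace ℝ (Fin 2 → ℝ) (Matrix.toLin' (shape τ ε ρ H m)) = H := by
  rw [LocalHelix.trace_toMatrix]
  simp [shape]

theorem hasConstantMeanCurvature (h : CurveData τ δ ε ρ H m κ ξ η a b)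
    (Ω : TopologicalSpace.Opens (Fin 2 → ℝ)) :
    HasConstantMeanCurvature τ δ (restrict Ω (vertical ξ η κ))
      (restrict Ω (verticalNormal τ ξ η a b)) H := by
  intro w
  refine ⟨(Matrix.toLin' (shape τ ε ρ H m) : (Fin 2 → ℝ) →ₗ[ℝ] (Fin 2 → ℝ)), fun X => ?_,
    trace_shape⟩
  unfold covDeriv
  rw [diff_restrict h.contDiff, diff_restrict h.contDiff_normal]
  exact h.fderiv_shape w X

theorem isFlat_of_isParametrizedBy (h : CurveData τ δ ε ρ H m κ ξ η a b) {M : Type*}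
    [TopologicalSpace M] [ChartedSpace (Fin 2 → ℝ) M] [IsManifold 𝓘(ℝ, Fin 2 → ℝ) ∞ M]
    {F : M → Fin 3 → ℝ} (hF : IsParametrizedBy τ δ F (vertical ξ η κ)) : IsFlat τ δ F :=
  IsFlat.of_isParametrizedBy (h.contDiff.differentiable (by simp)) hF h.firstForm_eq h.det_ne_zero

theorem isFlatCMCHelixModel (h : CurveData τ δ ε ρ H m κ ξ η a b) :
    IsFlatCMCHelixModel τ δ ε |H| (vertical ξ η κ) := by
  intro Ω
  have hh := h.isHelixSurface Ω
  refine ⟨_, H, rfl, hh, h.hasConstantMeanCurvature Ω, h.isFlat_of_isParametrizedBy ?_⟩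
  -- An open part is parametrized by its own model, through the identity motion and the inclusion,
  -- so the flatness criterion applies.
  refine isParametrizedBy_of_local hh.immersion (h.contDiff.differentiable (by simp))
    (isAmbientIsometry_motion τ δ 0 0 (s := 1) (by norm_num)) fun p =>
    ⟨Subtype.val, Set.univ, isOpen_univ, trivial, contMDiff_subtype_val.contMDiffOn, fun q _ => ?_⟩
  ext k
  simp only [motion, Equiv.coe_fn_mk, motionFun, restrict]
  revert k
  simp [Fin.forall_fin_succ]

end CurveData

/-! ### The model surfaces as vertical cylinders -/

theorem planeA_eq (φ₀ : ℝ) : planeA φ₀ =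
    vertical (fun v => Real.sin φ₀ * v) (fun v => -Real.cos φ₀ * v) 0 := by
  ext w : 1
  simp [planeA, vertical]

theorem planeB_eq (φ₀ : ℝ) : planeB φ₀ =
    vertical (fun v => Real.sinh φ₀ * v) (fun v => Real.cosh φ₀ * v) 0 := by
  ext w : 1
  simp [planeB, vertical]

theorem planeC_eq (φ₀ : ℝ) : planeC φ₀ =
    vertical (fun v => Real.cosh φ₀ * v) (fun v => Real.sinh φ₀ * v) 0 := by
  ext w : 1
  simp [planeC, vertical]

theorem cylinderA_eq (τ r : ℝ) : cylinderA τ r =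
    vertical (fun v => -(r * Real.cos v)) (fun v => -(r * Real.sin v)) (-(τ * r ^ 2)) := by
  ext w : 1
  simp [cylinderA, vertical, sub_eq_add_neg]

theorem cylinderB_eq (τ r : ℝ) : cylinderB τ r =
    vertical (fun v => r * Real.cosh v) (fun v => r * Real.sinh v) (-(τ * r ^ 2)) := by
  ext w : 1
  simp [cylinderB, vertical, sub_eq_add_neg]

theorem cylinderC_eq (τ r : ℝ) : cylinderC τ r =
    vertical (fun v => r * Real.sinh v) (fun v => r * Real.cosh v) (τ * r ^ 2) := by
  ext w : 1
  simp [cylinderC, vertical]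

/-- The plane with unit normal `(a, b)`. -/
theorem curveData_line (τ : ℝ) {δ ε a b : ℝ} (hδ : δ ^ 2 = 1) (hε : ε = 1 ∨ ε = -1)
    (hab : a ^ 2 - δ * b ^ 2 = ε) :
    CurveData τ δ ε 1 0 0 0 (fun v => δ * b * v) (fun v => a * v) (fun _ => a) (fun _ => b) where
  delta := hδ
  sign := hε
  speed := one_ne_zero
  smooth_fst := by fun_prop
  smooth_snd := by fun_prop
  normal_smooth_fst := by fun_prop
  normal_smooth_snd := by fun_prop
  deriv_fst t := by simpa using (hasDerivAt_id t).const_mul (δ * b)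
  deriv_snd t := by simpa using (hasDerivAt_id t).const_mul a
  normal_deriv_fst t := by simpa using hasDerivAt_const t a
  normal_deriv_snd t := by simpa using hasDerivAt_const t b
  unit _ := hab
  moment t := by ring

theorem curveData_planeA (τ φ₀ : ℝ) :
    CurveData τ (-1) 1 1 0 0 0 (fun v => Real.sin φ₀ * v) (fun v => -Real.cos φ₀ * v)
      (fun _ => -Real.cos φ₀) (fun _ => -Real.sin φ₀) := by
  have := curveData_line τ (δ := -1) (ε := 1) (a := -Real.cos φ₀) (b := -Real.sin φ₀) (by norm_num)
    (Or.inl rfl) (by linear_combination Real.sin_sq_add_cos_sq φ₀)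
  simpa using this

theorem curveData_planeB (τ φ₀ : ℝ) :
    CurveData τ 1 1 1 0 0 0 (fun v => Real.sinh φ₀ * v) (fun v => Real.cosh φ₀ * v)
      (fun _ => Real.cosh φ₀) (fun _ => Real.sinh φ₀) := by
  have := curveData_line τ (δ := 1) (ε := 1) (a := Real.cosh φ₀) (b := Real.sinh φ₀) (by norm_num)
    (Or.inl rfl) (by linear_combination Real.cosh_sq φ₀)
  simpa using this

theorem curveData_planeC (τ φ₀ : ℝ) :
    CurveData τ 1 (-1) 1 0 0 0 (fun v => Real.cosh φ₀ * v) (fun v => Real.sinh φ₀ * v)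
      (fun _ => Real.sinh φ₀) (fun _ => Real.cosh φ₀) := by
  have := curveData_line τ (δ := 1) (ε := -1) (a := Real.sinh φ₀) (b := Real.cosh φ₀)
    (by norm_num) (Or.inr rfl) (by linear_combination -Real.cosh_sq φ₀)
  simpa using this

/-- The normal is the horizontal position divided by r, which forces 2H = −1/r. The moment −2τr² is
the sum of κ and the equal term τ(ηξ' − ξη'). -/
theorem curveData_cylinderA (τ : ℝ) {r : ℝ} (hr : r ≠ 0) :
    CurveData τ (-1) 1 r (-(1 / (2 * r))) (-(2 * τ * r ^ 2)) (-(τ * r ^ 2))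
      (fun v => -(r * Real.cos v)) (fun v => -(r * Real.sin v))
      (fun v => -Real.cos v) (fun v => -Real.sin v) where
  delta := by norm_num
  sign := Or.inl rfl
  speed := hr
  smooth_fst := by fun_prop
  smooth_snd := by fun_prop
  normal_smooth_fst := by fun_prop
  normal_smooth_snd := by fun_prop
  deriv_fst t := (((Real.hasDerivAt_cos t).const_mul r).fun_neg).congr_deriv (by ring)
  deriv_snd t := (((Real.hasDerivAt_sin t).const_mul r).fun_neg).congr_deriv (by ring)
  normal_deriv_fst t := (Real.hasDerivAt_cos t).fun_neg.congr_deriv (by field_simp)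
  normal_deriv_snd t := (Real.hasDerivAt_sin t).fun_neg.congr_deriv (by field_simp)
  unit t := by linear_combination Real.sin_sq_add_cos_sq t
  moment t := by linear_combination (-τ * r ^ 2) * Real.sin_sq_add_cos_sq t

theorem curveData_cylinderB (τ : ℝ) {r : ℝ} (hr : r ≠ 0) :
    CurveData τ 1 1 r (-(1 / (2 * r))) (-(2 * τ * r ^ 2)) (-(τ * r ^ 2))
      (fun v => r * Real.cosh v) (fun v => r * Real.sinh v)
      (fun v => Real.cosh v) (fun v => Real.sinh v) where
  delta := by norm_num
  sign := Or.inl rfl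
  speed := hr
  smooth_fst := contDiff_const.mul Real.contDiff_cosh
  smooth_snd := contDiff_const.mul Real.contDiff_sinh
  normal_smooth_fst := Real.contDiff_cosh
  normal_smooth_snd := Real.contDiff_sinh
  deriv_fst t := ((Real.hasDerivAt_cosh t).const_mul r).congr_deriv (by ring)
  deriv_snd t := ((Real.hasDerivAt_sinh t).const_mul r).congr_deriv (by ring)
  normal_deriv_fst t := (Real.hasDerivAt_cosh t).congr_deriv (by field_simp)
  normal_deriv_snd t := (Real.hasDerivAt_sinh t).congr_deriv (by field_simp)
  unit t := by linear_combination Real.cosh_sq t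
  moment t := by linear_combination (-τ * r ^ 2) * Real.cosh_sq t

theorem curveData_cylinderC (τ : ℝ) {r : ℝ} (hr : r ≠ 0) :
    CurveData τ 1 (-1) r (-(1 / (2 * r))) (2 * τ * r ^ 2) (τ * r ^ 2)
      (fun v => r * Real.sinh v) (fun v => r * Real.cosh v)
      (fun v => Real.sinh v) (fun v => Real.cosh v) where
  delta := by norm_num
  sign := Or.inr rfl
  speed := hr
  smooth_fst := contDiff_const.mul Real.contDiff_sinh
  smooth_snd := contDiff_const.mul Real.contDiff_cosh
  normal_smooth_fst := Real.contDiff_sinh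
  normal_smooth_snd := Real.contDiff_cosh
  deriv_fst t := ((Real.hasDerivAt_sinh t).const_mul r).congr_deriv (by ring)
  deriv_snd t := ((Real.hasDerivAt_cosh t).const_mul r).congr_deriv (by ring)
  normal_deriv_fst t := (Real.hasDerivAt_sinh t).congr_deriv (by field_simp)
  normal_deriv_snd t := (Real.hasDerivAt_cosh t).congr_deriv (by field_simp)
  unit t := by linear_combination -Real.cosh_sq t
  moment t := by linear_combination (τ * r ^ 2) * Real.cosh_sq t

/-! ### Recognizing the model surfaces -/

theorem exists_angle {a b : ℝ} (h : a ^ 2 + b ^ 2 = 1) : ∃ t, a = Real.cos t ∧ b = Real.sin t := by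
  have hn : ‖(⟨a, b⟩ : ℂ)‖ = 1 := by
    rw [Complex.norm_eq_sqrt_sq_add_sq, h, Real.sqrt_one]
  refine ⟨Complex.arg ⟨a, b⟩, ?_, ?_⟩
  · rw [Complex.cos_arg (by intro h0; simp [h0] at hn), hn, div_one]
  · rw [Complex.sin_arg, hn, div_one]

theorem eq_cosh_of_sq {c t : ℝ} (hc : 0 < c) (h : c ^ 2 - Real.sinh t ^ 2 = 1) :
    c = Real.cosh t := by
  have : c ^ 2 = Real.cosh t ^ 2 := by rw [Real.cosh_sq]; linarith
  exact (pow_left_inj₀ hc.le (Real.cosh_pos t).le two_ne_zero).1 this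

theorem exists_hyperbolic_angle {a b : ℝ} (h : a ^ 2 - b ^ 2 = 1) :
    ∃ s t, s ^ 2 = 1 ∧ a = s * Real.cosh t ∧ b = s * Real.sinh t := by
  have ha : a ≠ 0 := by rintro rfl; nlinarith [sq_nonneg b]
  rcases ha.lt_or_gt with h0 | h0
  · refine ⟨-1, Real.arsinh (-b), by norm_num, ?_, ?_⟩
    · rw [← eq_cosh_of_sq (c := -a) (by linarith) (by rw [Real.sinh_arsinh]; linarith)]
      ring
    · rw [Real.sinh_arsinh]
      ring
  · refine ⟨1, Real.arsinh b, by norm_num, ?_, ?_⟩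
    · rw [← eq_cosh_of_sq (c := a) h0 (by rw [Real.sinh_arsinh]; linarith)]
      ring
    · rw [Real.sinh_arsinh]
      ring

/-- A nowhere vanishing continuous function on a connected space has constant sign. -/
theorem exists_sign {X : Type*} [TopologicalSpace X] [ConnectedSpace X] {f : X → ℝ}
    (hf : Continuous f) (h0 : ∀ q, f q ≠ 0) :
    ∃ s : ℝ, s ^ 2 = 1 ∧ ∀ q, 0 < s * f q := by
  obtain ⟨p⟩ := (inferInstance : Nonempty X)
  rcases (h0 p).lt_or_gt with hp | hp
  · refine ⟨-1, by norm_num, fun q => ?_⟩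
    by_contra! hq
    obtain ⟨r, hr⟩ := mem_range_of_exists_le_of_exists_ge hf ⟨p, hp.le⟩ ⟨q, by linarith⟩
    exact h0 r hr
  · refine ⟨1, by norm_num, fun q => ?_⟩
    by_contra! hq
    obtain ⟨r, hr⟩ := mem_range_of_exists_le_of_exists_ge hf ⟨q, by linarith⟩ ⟨p, hp.le⟩
    exact h0 r hr

section Classification

variable {M : Type*} [TopologicalSpace M] [ChartedSpace (Fin 2 → ℝ) M]
  [IsManifold 𝓘(ℝ, Fin 2 → ℝ) ∞ M]

/-- A surface whose horizontal projection runs, up to a half turn and a translation, in the plane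
curve `(ξ, η)` is parametrized by the vertical cylinder over this curve. -/
theorem isParametrizedBy_vertical {τ δ ε ρ H m κ : ℝ} {ξ η a b : ℝ → ℝ}
    (hc : CurveData τ δ ε ρ H m κ ξ η a b) {F : M → Fin 3 → ℝ}
    (hF : ContMDiff 𝓘(ℝ, Fin 2 → ℝ) 𝓘(ℝ, Fin 3 → ℝ) ∞ F)
    (himm : ∀ p, Function.Injective (diff F p)) {s x₀ y₀ : ℝ} (hs : s ^ 2 = 1)
    (hloc : ∀ p, ∃ (W : Set (Fin 3 → ℝ)) (f : (Fin 3 → ℝ) → ℝ), IsOpen W ∧ F p ∈ W ∧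
      ContDiffOn ℝ ∞ f W ∧ ∀ q, F q ∈ W →
        F q 0 = s * ξ (f (F q)) + x₀ ∧ F q 1 = s * η (f (F q)) + y₀) :
    IsParametrizedBy τ δ F (vertical ξ η κ) := by
  refine isParametrizedBy_of_local himm (hc.contDiff.differentiable (by simp))
    (isAmbientIsometry_motion τ δ x₀ y₀ hs) fun p => ?_
  obtain ⟨W, f, hW, hp, hf, hq⟩ := hloc p
  -- The first coordinate comes from solving the third component of the motion for u, with sξ and sη
  -- replaced by x − x₀ and y − y₀.
  refine ⟨(fun x : Fin 3 → ℝ => ![x 2 - τ * (x₀ * (x 1 - y₀) - y₀ * (x 0 - x₀)) - κ * f x, f x]) ∘ F,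
    F ⁻¹' W, hW.preimage hF.continuous, hp, ?_, fun q hqW => ?_⟩
  · have h1 : ContDiffOn ℝ ∞ (fun x : Fin 3 → ℝ =>
        ![x 2 - τ * (x₀ * (x 1 - y₀) - y₀ * (x 0 - x₀)) - κ * f x, f x]) W := by
      rw [contDiffOn_pi]
      simp only [Fin.forall_fin_two]
      refine ⟨?_, ?_⟩ <;> simp <;> fun_prop
    exact h1.contMDiffOn.comp hF.contMDiffOn fun q hq => hq
  · obtain ⟨h0, h1⟩ := hq q hqW
    ext k
    simp only [motion, Equiv.coe_fn_mk, motionFun, Function.comp, vertical]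
    revert k
    simp only [Fin.forall_fin_succ]
    refine ⟨?_, ?_, ?_, fun i => i.elim0⟩
    · simpa using h0
    · simpa using h1
    · simp
      rw [h0, h1]
      ring

variable {τ δ ε H : ℝ} {F N : M → Fin 3 → ℝ}

/-- A surface with horizontal normal `(α, β)` is parametrized by a plane. -/
theorem IsHelixSurface.isParametrizedBy_line [ConnectedSpace M]
    (hδ : δ = 1 ∨ δ = -1) (h : IsHelixSurface τ δ ε 0 F N)
    (hH : HasConstantMeanCurvature τ δ F N 0) {α β s a b : ℝ} (hα : ∀ q, N q 0 = α)
    (hβ : ∀ q, N q 1 = β) (hs : s ^ 2 = 1) (ha : α = s * a) (hb : β = s * b) :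
    IsParametrizedBy τ δ F (vertical (fun v => δ * b * v) (fun v => a * v) 0) := by
  have hδ2 : δ ^ 2 = 1 := by rcases hδ with rfl | rfl <;> norm_num
  have hε : ε ^ 2 = 1 := by rcases h.sign with h | h <;> rw [h] <;> norm_num
  obtain ⟨p⟩ := (inferInstance : Nonempty M)
  have hu := (h.unit_of_zero hδ p).1
  rw [hα, hβ] at hu
  have hab : a ^ 2 - δ * b ^ 2 = ε := by
    rw [ha, hb] at hu
    linear_combination hu - (a ^ 2 - δ * b ^ 2) * hs
  -- With constant horizontal normal, tangency says exactly that this linear function has zero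
  -- differential.
  obtain ⟨k, hk⟩ := exists_const_of_fderiv_eq_zero (fun q => a * F q 0 - δ * b * F q 1) (by
    intro p w hw
    have hl := h.localHelix hδ2 hH (IsManifold.chart_mem_maximalAtlas p)
    have g0 := hl.differentiableAt hw 0
    have g1 := hl.differentiableAt hw 1
    refine ⟨(g0.const_mul _).sub (g1.const_mul _), ?_⟩
    have hn : ∀ i, a * partialD i (fun q => (F ∘ (chartAt (Fin 2 → ℝ) p).symm) q 0) w
        - δ * b * partialD i (fun q => (F ∘ (chartAt (Fin 2 → ℝ) p).symm) q 1) w = 0 := by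
      intro i
      have := hl.normal_eq hw i
      simp only [Function.comp_apply, hα, hβ, mul_zero, zero_mul, add_zero] at this
      rw [ha, hb] at this
      simp only [Function.comp_apply]
      linear_combination s * this - (a * partialD i
        (fun q => F ((chartAt (Fin 2 → ℝ) p).symm q) 0) w - δ * b * partialD i
        (fun q => F ((chartAt (Fin 2 → ℝ) p).symm q) 1) w) * hs
    ext v
    change fderiv ℝ (fun x => a * (F ∘ (chartAt (Fin 2 → ℝ) p).symm) x 0
      - δ * b * (F ∘ (chartAt (Fin 2 → ℝ) p).symm) x 1) w v = 0
    rw [fderiv_apply_eq_sum]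
    refine Finset.sum_eq_zero fun i _ => ?_
    simp (disch := fun_prop) only [partialD_sub, partialD_mul, partialD_const]
    linear_combination v i * hn i)
  -- The base point εk(a, b) is the multiple of the normal lying on the line a x − δb y = k, and the
  -- parameter is the coordinate along the direction (δb, a). The sign `s` only reverses the normal,
  -- so no half turn is needed.
  refine isParametrizedBy_vertical (curveData_line τ hδ2 h.sign hab) h.smooth h.immersion
    (s := 1) (x₀ := ε * k * a) (y₀ := ε * k * b) (by norm_num) fun p =>
    ⟨Set.univ, fun x => ε * (a * (x 1 - ε * k * b) - b * (x 0 - ε * k * a)), isOpen_univ, trivial,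
      by fun_prop, fun q _ => ?_⟩
  constructor <;> rw [← hk q]
  · linear_combination (-ε * F q 0) * hab - F q 0 * hε
  · linear_combination (-ε * F q 1) * hab - F q 1 * hε

/-- A surface over a circle. -/
theorem isParametrizedBy_cylinderA {r x₀ y₀ : ℝ} (hr : 0 < r)
    (hF : ContMDiff 𝓘(ℝ, Fin 2 → ℝ) 𝓘(ℝ, Fin 3 → ℝ) ∞ F)
    (himm : ∀ p, Function.Injective (diff F p))
    (hq : ∀ q, (F q 0 - x₀) ^ 2 + (F q 1 - y₀) ^ 2 = r ^ 2) :
    IsParametrizedBy τ (-1) F (cylinderA τ r) := by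
  rw [cylinderA_eq]
  refine isParametrizedBy_vertical (curveData_cylinderA τ hr.ne') hF himm (s := 1) (x₀ := x₀)
    (y₀ := y₀) (by norm_num) fun p => ?_
  obtain ⟨t, hc, hs⟩ := exists_angle (a := -(F p 0 - x₀) / r) (b := -(F p 1 - y₀) / r) (by
    field_simp
    linarith [hq p])
  have hcs := Real.sin_sq_add_cos_sq t
  -- On the circle, `C` and `S` are the cosine and sine of the angle measured from that of F(p).
  -- Where C > 0 the angle is a smooth function, t + arcsin S.
  set C : (Fin 3 → ℝ) → ℝ := fun x => -((x 0 - x₀) * Real.cos t + (x 1 - y₀) * Real.sin t) / r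
    with hC
  set S : (Fin 3 → ℝ) → ℝ := fun x => ((x 0 - x₀) * Real.sin t - (x 1 - y₀) * Real.cos t) / r
    with hS
  have hSd : ContDiff ℝ ∞ S := by fun_prop
  have hCc : Continuous C := by fun_prop
  have hSc : Continuous S := hSd.continuous
  refine ⟨{x | 0 < C x} ∩ {x | -1 < S x} ∩ {x | S x < 1}, fun x => t + Real.arcsin (S x),
    ((isOpen_lt continuous_const hCc).inter (isOpen_lt continuous_const hSc)).inter
      (isOpen_lt hSc continuous_const), ?_, ?_, ?_⟩
  · have e0 : F p 0 - x₀ = -(r * Real.cos t) := by rw [← hc]; field_simp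
    have e1 : F p 1 - y₀ = -(r * Real.sin t) := by rw [← hs]; field_simp
    have hC1 : C (F p) = 1 := by
      simp only [hC, e0, e1]
      field_simp
      linear_combination hcs
    have hS0 : S (F p) = 0 := by
      simp only [hS, e0, e1]
      ring
    refine ⟨⟨?_, ?_⟩, ?_⟩
    · change 0 < C (F p)
      rw [hC1]; norm_num
    · change -1 < S (F p)
      rw [hS0]; norm_num
    · change S (F p) < 1
      rw [hS0]; norm_num
  · intro x hx
    have : ContDiffAt ℝ ∞ (fun x => t + Real.arcsin (S x)) x :=
      contDiffAt_const.add ((Real.contDiffAt_arcsin (ne_of_gt hx.1.2) (ne_of_lt hx.2)).comp x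
        hSd.contDiffAt)
    exact this.contDiffWithinAt
  · intro q hqW
    obtain ⟨⟨h1, h2⟩, h3⟩ := hqW
    have hsum : C (F q) ^ 2 + S (F q) ^ 2 = 1 := by
      simp only [hC, hS]
      field_simp
      linear_combination hq q + ((F q 0 - x₀) ^ 2 + (F q 1 - y₀) ^ 2) * hcs
    have hcos : Real.cos (Real.arcsin (S (F q))) = C (F q) := by
      rw [Real.cos_arcsin, show 1 - S (F q) ^ 2 = C (F q) ^ 2 by linarith]
      exact Real.sqrt_sq (le_of_lt h1)
    have hsin : Real.sin (Real.arcsin (S (F q))) = S (F q) :=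
      Real.sin_arcsin (le_of_lt h2) (le_of_lt h3)
    rw [Real.cos_add, Real.sin_add, hcos, hsin]
    simp only [hC, hS]
    constructor
    · field_simp
      linear_combination (-(F q 0 - x₀)) * hcs
    · field_simp
      linear_combination (-(F q 1 - y₀)) * hcs

/-- A surface over a timelike hyperbola. -/
theorem isParametrizedBy_cylinderB [ConnectedSpace M] {r x₀ y₀ : ℝ} (hr : 0 < r)
    (hF : ContMDiff 𝓘(ℝ, Fin 2 → ℝ) 𝓘(ℝ, Fin 3 → ℝ) ∞ F)
    (himm : ∀ p, Function.Injective (diff F p))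
    (hq : ∀ q, (F q 0 - x₀) ^ 2 - (F q 1 - y₀) ^ 2 = r ^ 2) :
    IsParametrizedBy τ 1 F (cylinderB τ r) := by
  rw [cylinderB_eq]
  -- By connectedness the projection stays on one branch of the hyperbola; the half turn s = −1
  -- carries the model branch to the opposite one.
  obtain ⟨s, hs, hpos⟩ := exists_sign (f := fun q => F q 0 - x₀)
    (((continuous_apply 0).comp hF.continuous).sub continuous_const) (fun q h0 => by
      have := hq q
      rw [h0] at this
      nlinarith [sq_nonneg (F q 1 - y₀), pow_pos hr 2])
  refine isParametrizedBy_vertical (curveData_cylinderB τ hr.ne') hF himm (x₀ := x₀)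
    (y₀ := y₀) hs fun p => ⟨Set.univ, fun x => Real.arsinh (s * (x 1 - y₀) / r), isOpen_univ,
      trivial, (Real.contDiff_arsinh.comp (by fun_prop)).contDiffOn, fun q _ => ?_⟩
  rw [← eq_cosh_of_sq (c := s * (F q 0 - x₀) / r) (div_pos (hpos q) hr), Real.sinh_arsinh]
  · constructor
    · field_simp
      linear_combination (-(F q 0 - x₀)) * hs
    · field_simp
      linear_combination (-(F q 1 - y₀)) * hs
  · rw [Real.sinh_arsinh]
    field_simp
    linear_combination hq q + ((F q 0 - x₀) ^ 2 - (F q 1 - y₀) ^ 2) * hs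

/-- A surface over a spacelike hyperbola. -/
theorem isParametrizedBy_cylinderC [ConnectedSpace M] {r x₀ y₀ : ℝ} (hr : 0 < r)
    (hF : ContMDiff 𝓘(ℝ, Fin 2 → ℝ) 𝓘(ℝ, Fin 3 → ℝ) ∞ F)
    (himm : ∀ p, Function.Injective (diff F p))
    (hq : ∀ q, (F q 1 - y₀) ^ 2 - (F q 0 - x₀) ^ 2 = r ^ 2) :
    IsParametrizedBy τ 1 F (cylinderC τ r) := by
  rw [cylinderC_eq]
  obtain ⟨s, hs, hpos⟩ := exists_sign (f := fun q => F q 1 - y₀)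
    (((continuous_apply 1).comp hF.continuous).sub continuous_const) (fun q h0 => by
      have := hq q
      rw [h0] at this
      nlinarith [sq_nonneg (F q 0 - x₀), pow_pos hr 2])
  refine isParametrizedBy_vertical (curveData_cylinderC τ hr.ne') hF himm (x₀ := x₀)
    (y₀ := y₀) hs fun p => ⟨Set.univ, fun x => Real.arsinh (s * (x 0 - x₀) / r), isOpen_univ,
      trivial, (Real.contDiff_arsinh.comp (by fun_prop)).contDiffOn, fun q _ => ?_⟩
  rw [← eq_cosh_of_sq (c := s * (F q 1 - y₀) / r) (div_pos (hpos q) hr), Real.sinh_arsinh]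
  · constructor
    · field_simp
      linear_combination (-(F q 0 - x₀)) * hs
    · field_simp
      linear_combination (-(F q 1 - y₀)) * hs
  · rw [Real.sinh_arsinh]
    field_simp
    linear_combination hq q + ((F q 1 - y₀) ^ 2 - (F q 0 - x₀) ^ 2) * hs

/-- Constant angle surfaces with `ν = 0` and `H ≠ 0` lie over a circle or a hyperbola. -/
theorem IsHelixSurface.exists_radius [ConnectedSpace M] (hδ : δ = 1 ∨ δ = -1)
    (h : IsHelixSurface τ δ ε 0 F N) (hH : HasConstantMeanCurvature τ δ F N H) (hH0 : H ≠ 0) :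
    ∃ x₀ y₀ : ℝ, ∀ q, (F q 0 - x₀) ^ 2 - δ * (F q 1 - y₀) ^ 2 = ε * (1 / (2 * |H|)) ^ 2 := by
  obtain ⟨α, β, hc⟩ := h.exists_center hδ hH
  refine ⟨α / (2 * H), β / (2 * H), fun q => ?_⟩
  obtain ⟨h0, h1⟩ := hc q
  have hu := (h.unit_of_zero hδ q).1
  -- The horizontal part of F minus the centre is −N/(2H), so the unit condition on N becomes the
  -- equation of the conic.
  have e0 : F q 0 - α / (2 * H) = -(N q 0) / (2 * H) := by
    rw [← h0]; field_simp; ring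
  have e1 : F q 1 - β / (2 * H) = -(N q 1) / (2 * H) := by
    rw [← h1]; field_simp; ring
  have e2 : (1 / (2 * |H|)) ^ 2 = 1 / (4 * H ^ 2) := by
    rw [div_pow, mul_pow, sq_abs]; norm_num
  rw [e0, e1, e2, ← hu]
  field_simp
  ring

end Classification

/-! ### The classification -/

section Theorems

variable {M : Type*} [TopologicalSpace M] [ChartedSpace (Fin 2 → ℝ) M]
  [IsManifold 𝓘(ℝ, Fin 2 → ℝ) ∞ M] [ConnectedSpace M] {τ δ ε ν H : ℝ} {F N : M → Fin 3 → ℝ}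

theorem eq_one_of_add_sq {a b : ℝ} (hε : ε = 1 ∨ ε = -1) (h : a ^ 2 - -1 * b ^ 2 = ε) : ε = 1 := by
  rcases hε with rfl | rfl
  · rfl
  · nlinarith [sq_nonneg a, sq_nonneg b]

/-- Minimal constant angle surfaces are planes. -/
theorem minimal_classification (hτ : τ ≠ 0) (hδ : δ = 1 ∨ δ = -1)
    (h : IsHelixSurface τ δ ε ν F N) (hmin : IsMinimal τ δ F N) :
    IsFlat τ δ F ∧
      (δ = -1 → IsTimelike τ δ F ∧ ∃ φ₀, IsParametrizedBy τ δ F (planeA φ₀)) ∧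
      (δ = 1 →
        (IsTimelike τ δ F ∧ ∃ φ₀, IsParametrizedBy τ δ F (planeB φ₀)) ∨
        (IsSpacelike τ δ F ∧ ∃ φ₀, IsParametrizedBy τ δ F (planeC φ₀))) := by
  -- A nonzero angle would give 0 = H² = τ²ν² > 0.
  obtain rfl : ν = 0 := by
    by_contra hν
    have := (h.eq_one_of_ne_zero hτ hδ hmin hν).2
    have : 0 < τ ^ 2 * ν ^ 2 := by positivity
    linarith
  obtain ⟨α, β, hc⟩ := h.exists_center hδ hmin
  simp only [mul_zero, zero_mul, add_zero] at hc
  have hα := fun q => (hc q).1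
  have hβ := fun q => (hc q).2
  obtain ⟨p⟩ := (inferInstance : Nonempty M)
  have hu := (h.unit_of_zero hδ p).1
  rw [hα, hβ] at hu
  rcases hδ with rfl | rfl
  · rcases h.sign with rfl | rfl
    · obtain ⟨s, t, hs, ha, hb⟩ := exists_hyperbolic_angle (a := α) (b := β) (by linarith)
      have hpar := h.isParametrizedBy_line (Or.inl rfl) hmin hα hβ hs ha hb
      simp only [one_mul] at hpar
      have hd := curveData_planeB τ t
      refine ⟨hd.isFlat_of_isParametrizedBy hpar, by norm_num, fun _ => Or.inl
        ⟨(hd.isTimelike rfl (Or.inl rfl)).of_isParametrizedBy h.smooth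
          (hd.contDiff.differentiable (by simp)) hpar, t, ?_⟩⟩
      rwa [planeB_eq]
    · obtain ⟨s, t, hs, hb, ha⟩ := exists_hyperbolic_angle (a := β) (b := α) (by linarith)
      have hpar := h.isParametrizedBy_line (Or.inl rfl) hmin hα hβ hs ha hb
      simp only [one_mul] at hpar
      have hd := curveData_planeC τ t
      refine ⟨hd.isFlat_of_isParametrizedBy hpar, by norm_num, fun _ => Or.inr
        ⟨hd.isSpacelike.of_isParametrizedBy h.smooth
          (hd.contDiff.differentiable (by simp)) hpar, t, ?_⟩⟩
      rwa [planeC_eq]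
  · obtain rfl := eq_one_of_add_sq h.sign hu
    -- The signs match the normal (−cos φ₀, −sin φ₀) of `planeA`.
    obtain ⟨t, ha, hb⟩ := exists_angle (a := -α) (b := -β) (by linarith)
    have hpar := h.isParametrizedBy_line (Or.inr rfl) hmin hα hβ (s := 1) (by norm_num)
      (a := -Real.cos t) (b := -Real.sin t) (by linarith) (by linarith)
    simp only [neg_mul_neg, one_mul] at hpar
    have hd := curveData_planeA τ t
    refine ⟨hd.isFlat_of_isParametrizedBy hpar, fun _ =>
      ⟨(hd.isTimelike rfl (Or.inr rfl)).of_isParametrizedBy h.smooth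
        (hd.contDiff.differentiable (by simp)) hpar, t, ?_⟩, by norm_num⟩
    rwa [planeA_eq]

/-- Constant angle surfaces of non-zero constant mean curvature with `ν = 0` are cylinders. -/
theorem cmc_classification (hδ : δ = 1 ∨ δ = -1) (h : IsHelixSurface τ δ ε 0 F N)
    (hH : HasConstantMeanCurvature τ δ F N H) (hH0 : H ≠ 0) :
    IsFlat τ δ F ∧
      (δ = -1 → IsTimelike τ δ F ∧ IsParametrizedBy τ δ F (cylinderA τ (1 / (2 * |H|)))) ∧
      (δ = 1 →
        (IsTimelike τ δ F ∧ IsParametrizedBy τ δ F (cylinderB τ (1 / (2 * |H|)))) ∨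
        (IsSpacelike τ δ F ∧ IsParametrizedBy τ δ F (cylinderC τ (1 / (2 * |H|))))) := by
  obtain ⟨x₀, y₀, hq⟩ := h.exists_radius hδ hH hH0
  have hr : 0 < 1 / (2 * |H|) := by positivity
  rcases hδ with rfl | rfl
  · rcases h.sign with rfl | rfl
    · have hpar := isParametrizedBy_cylinderB (τ := τ) hr h.smooth h.immersion
        (x₀ := x₀) (y₀ := y₀) fun q => by linarith [hq q]
      have hd := curveData_cylinderB τ hr.ne'
      have hpar' := hpar
      rw [cylinderB_eq] at hpar'
      exact ⟨hd.isFlat_of_isParametrizedBy hpar', by norm_num, fun _ => Or.inl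
        ⟨(hd.isTimelike rfl (Or.inl rfl)).of_isParametrizedBy h.smooth
          (hd.contDiff.differentiable (by simp)) hpar', hpar⟩⟩
    · have hpar := isParametrizedBy_cylinderC (τ := τ) hr h.smooth h.immersion
        (x₀ := x₀) (y₀ := y₀) fun q => by linarith [hq q]
      have hd := curveData_cylinderC τ hr.ne'
      have hpar' := hpar
      rw [cylinderC_eq] at hpar'
      exact ⟨hd.isFlat_of_isParametrizedBy hpar', by norm_num, fun _ => Or.inr
        ⟨hd.isSpacelike.of_isParametrizedBy h.smooth
          (hd.contDiff.differentiable (by simp)) hpar', hpar⟩⟩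
  · obtain ⟨p⟩ := (inferInstance : Nonempty M)
    obtain rfl := eq_one_of_add_sq h.sign (h.unit_of_zero (Or.inr rfl) p).1
    have hpar := isParametrizedBy_cylinderA (τ := τ) hr h.smooth h.immersion
      (x₀ := x₀) (y₀ := y₀) fun q => by linarith [hq q]
    have hd := curveData_cylinderA τ hr.ne'
    have hpar' := hpar
    rw [cylinderA_eq] at hpar'
    exact ⟨hd.isFlat_of_isParametrizedBy hpar', fun _ =>
      ⟨(hd.isTimelike rfl (Or.inr rfl)).of_isParametrizedBy h.smooth
        (hd.contDiff.differentiable (by simp)) hpar', hpar⟩, by norm_num⟩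

end Theorems

/-! ### The converse: planes and cylinders are constant angle surfaces -/

theorem planes_are_models (τ φ₀ : ℝ) :
    (IsFlatCMCHelixModel τ (-1) 1 0 (planeA φ₀) ∧ IsTimelike τ (-1) (planeA φ₀)) ∧
    (IsFlatCMCHelixModel τ 1 1 0 (planeB φ₀) ∧ IsTimelike τ 1 (planeB φ₀)) ∧
    (IsFlatCMCHelixModel τ 1 (-1) 0 (planeC φ₀) ∧ IsSpacelike τ 1 (planeC φ₀)) := by
  rw [planeA_eq, planeB_eq, planeC_eq]
  have hA := curveData_planeA τ φ₀
  have hB := curveData_planeB τ φ₀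
  have hC := curveData_planeC τ φ₀
  exact ⟨⟨by simpa using hA.isFlatCMCHelixModel, hA.isTimelike rfl (Or.inr rfl)⟩,
    ⟨by simpa using hB.isFlatCMCHelixModel, hB.isTimelike rfl (Or.inl rfl)⟩,
    by simpa using hC.isFlatCMCHelixModel, hC.isSpacelike⟩

theorem cylinders_are_models (τ : ℝ) {r : ℝ} (hr : 0 < r) :
    (IsFlatCMCHelixModel τ (-1) 1 (1 / (2 * r)) (cylinderA τ r) ∧
      IsTimelike τ (-1) (cylinderA τ r)) ∧
    (IsFlatCMCHelixModel τ 1 1 (1 / (2 * r)) (cylinderB τ r) ∧ IsTimelike τ 1 (cylinderB τ r)) ∧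
    (IsFlatCMCHelixModel τ 1 (-1) (1 / (2 * r)) (cylinderC τ r) ∧
      IsSpacelike τ 1 (cylinderC τ r)) := by
  rw [cylinderA_eq, cylinderB_eq, cylinderC_eq]
  have hA := curveData_cylinderA τ hr.ne'
  have hB := curveData_cylinderB τ hr.ne'
  have hC := curveData_cylinderC τ hr.ne'
  have habs : |(-(1 / (2 * r)))| = 1 / (2 * r) := by
    rw [abs_neg, abs_of_pos (by positivity)]
  exact ⟨⟨habs ▸ hA.isFlatCMCHelixModel, hA.isTimelike rfl (Or.inr rfl)⟩,
    ⟨habs ▸ hB.isFlatCMCHelixModel, hB.isTimelike rfl (Or.inl rfl)⟩,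
    habs ▸ hC.isFlatCMCHelixModel, hC.isSpacelike⟩

end LorentzHeisenberg

end

open LorentzHeisenberg in
/-- Minimal and proper CMC constant angle surfaces of the Lorentzian Heisenberg group. -/
theorem theorem4p4 (τ δ : ℝ) (hτ : τ ≠ 0) (hδ : δ = 1 ∨ δ = -1) :
    -- minimal constant angle surfaces are flat planes
    (∀ (M : Type*) [TopologicalSpace M] [ChartedSpace (Fin 2 → ℝ) M]
        [IsManifold 𝓘(ℝ, Fin 2 → ℝ) ∞ M] [ConnectedSpace M]
        (ε ν : ℝ) (F N : M → Fin 3 → ℝ),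
        IsHelixSurface τ δ ε ν F N → IsMinimal τ δ F N →
        IsFlat τ δ F ∧
        (δ = -1 → IsTimelike τ δ F ∧ ∃ φ₀, IsParametrizedBy τ δ F (planeA φ₀)) ∧
        (δ = 1 →
          (IsTimelike τ δ F ∧ ∃ φ₀, IsParametrizedBy τ δ F (planeB φ₀)) ∨
          (IsSpacelike τ δ F ∧ ∃ φ₀, IsParametrizedBy τ δ F (planeC φ₀)))) ∧
    -- all these planes are minimal constant angle surfaces
    (∀ φ₀ : ℝ,
        (δ = -1 → IsFlatCMCHelixModel τ δ 1 0 (planeA φ₀) ∧ IsTimelike τ δ (planeA φ₀)) ∧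
        (δ = 1 → IsFlatCMCHelixModel τ δ 1 0 (planeB φ₀) ∧ IsTimelike τ δ (planeB φ₀)) ∧
        (δ = 1 → IsFlatCMCHelixModel τ δ (-1) 0 (planeC φ₀) ∧
          IsSpacelike τ δ (planeC φ₀))) ∧
    -- open parts of the cylinders (in particular for `r = 1`) are flat proper CMC helix surfaces
    (∀ r : ℝ, 0 < r →
        (δ = -1 → IsFlatCMCHelixModel τ δ 1 (1 / (2 * r)) (cylinderA τ r) ∧
          IsTimelike τ δ (cylinderA τ r)) ∧
        (δ = 1 → IsFlatCMCHelixModel τ δ 1 (1 / (2 * r)) (cylinderB τ r) ∧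
          IsTimelike τ δ (cylinderB τ r)) ∧
        (δ = 1 → IsFlatCMCHelixModel τ δ (-1) (1 / (2 * r)) (cylinderC τ r) ∧
          IsSpacelike τ δ (cylinderC τ r))) ∧
    -- proper CMC constant angle surfaces are such cylinders, unless `δ = 1` and `H² = τ² ν²`
    (∀ (M : Type*) [TopologicalSpace M] [ChartedSpace (Fin 2 → ℝ) M]
        [IsManifold 𝓘(ℝ, Fin 2 → ℝ) ∞ M] [ConnectedSpace M]
        (ε ν H : ℝ) (F N : M → Fin 3 → ℝ),
        IsHelixSurface τ δ ε ν F N → HasConstantMeanCurvature τ δ F N H → H ≠ 0 →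
        (ν = 0 ∧ IsFlat τ δ F ∧
          (δ = -1 → IsTimelike τ δ F ∧
            IsParametrizedBy τ δ F (cylinderA τ (1 / (2 * |H|)))) ∧
          (δ = 1 →
            (IsTimelike τ δ F ∧ IsParametrizedBy τ δ F (cylinderB τ (1 / (2 * |H|)))) ∨
            (IsSpacelike τ δ F ∧ IsParametrizedBy τ δ F (cylinderC τ (1 / (2 * |H|)))))) ∨
        (δ = 1 ∧ H ^ 2 = τ ^ 2 * ν ^ 2)) := by
  refine ⟨fun M _ _ _ _ ε ν F N h hmin => minimal_classification hτ hδ h hmin, fun φ₀ => ?_,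
    fun r hr => ?_, fun M _ _ _ _ ε ν H F N h hH hH0 => ?_⟩
  · obtain ⟨hA, hB, hC⟩ := planes_are_models τ φ₀
    refine ⟨?_, ?_, ?_⟩ <;> rintro rfl <;> assumption
  · obtain ⟨hA, hB, hC⟩ := cylinders_are_models τ hr
    refine ⟨?_, ?_, ?_⟩ <;> rintro rfl <;> assumption
  · rcases eq_or_ne ν 0 with rfl | hν
    · exact Or.inl ⟨rfl, cmc_classification hδ h hH hH0⟩
    · exact Or.inr (h.eq_one_of_ne_zero hτ hδ hH hν)
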